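/- **Setting.** Let $d,n\in\mathbb N$, let $A_1,\dots,A_d\in\mathbb R^{n\times n}$ be symmetric, $E\in\mathbb R^{n\times n}$ skew-symmetric, and $T:\mathbb R^n\times\mathbb R^n\times\mathbb R^n\to\mathbb R^n$ trilinear; the trilinear extension to $\mathbb C^n$ is also denoted by $T$, and $|T(a,b,c)|_2\le C_T|a|_2|b|_2|c|_2$ for all $a,b,c\in\mathbb C^n$. Put $A(\beta)=\sum_\ell\beta_\ell A_\ell$ and $L(\alpha,\beta)=-\alpha I+A(\beta)-\mathrm iE$ for $\alpha\in\mathbb R$, $\beta\in\mathbb R^d$. Let $\kappa\in\mathbb R^d\setminus\{0\}$ and $\omega\in\mathbb R$. With $\widehat f(k)=(2\pi)^{-d/2}\int f(x)e^{-\mathrm ik\cdot x}\,dx$, let $W$ be the space of $f:\mathbb R^d\to\mathbb C^n$ with $\widehat f\in L^1$, $\|f\|_W=\int|\widehat f(k)|_2\,dk$, and let $W^1$ be the space of $f\in W$ with $\partial_\ell f\in W$ for all $\ell$, $\|f\|_{W^1}=\|f\|_W+\sum_\ell\|\partial_\ell f\|_W$. Let $p\in W^1$ and $t_{\rm end}>0$.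 For $\varepsilon\in(0,1]$ let $u=(u_1,u_3)$, $u_j\in C^1([0,t_{\rm end}/\varepsilon],W)\cap C([0,t_{\rm end}/\varepsilon],W^1)$, be a classical solution of $$\partial_t u_j+\tfrac{\mathrm i}{\varepsilon}L(j\omega,j\kappa)u_j+\sum_{\ell=1}^dA_\ell\partial_\ell u_j=\varepsilon\sum_{\substack{j_1,j_2,j_3\in\{\pm1,\pm3\}\\ j_1+j_2+j_3=j}}T(u_{j_1},u_{j_2},u_{j_3}),\qquad j\in\{1,3\},\ t\in(0,t_{\rm end}/\varepsilon],$$ where $u_{-j}=\overline{u_j}$, with $u_1(0)=p$ and $u_3(0)=0$. **Assumption 1.** $\ker L(\omega,\kappa)$ is one-dimensional; $p(x)\in\ker L(\omega,\kappa)$ for all $x$; $L(3\omega,3\kappa)$ and $L(5\omega,5\kappa)$ are invertible. **Assumption 2.** There are $\lambda_\ell:\mathbb R^d\to\mathbb R$ and $\psi_\ell:\mathbb R^d\to\mathbb C^n$, $\ell=1,\dots,n$, such that for every $\beta$ the vectors $\psi_1(\beta),\dots,\psi_n(\beta)$ are orthonormal with $L(0,\beta)\psi_\ell(\beta)=\lambda_\ell(\beta)\psi_\ell(\beta)$;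 all $\lambda_\ell$ and $\psi_\ell$ are $C^\infty$ on $\mathbb R^d\setminus\{0\}$; and $|\lambda_\ell(\widetilde\beta)-\lambda_\ell(\beta)|\le K|\widetilde\beta-\beta|_1$ for all $\beta,\widetilde\beta\in\mathbb R^d$. Number the eigenvalues such that $\lambda_1(\kappa)=\omega$. For $j\in\{1,3\}$ let $\Lambda_j(\theta)$ be the diagonal matrix with entries $\lambda_{j\ell}(\theta)=\lambda_\ell(j\kappa+\theta)-j\omega$, let $\Psi_j(\theta)$ be the unitary matrix with columns $\psi_\ell(j\kappa+\theta)$, and define $$z_j(t,k)=S_{j,\varepsilon}(t,k)\,\widehat u_j(t,k),\qquad S_{j,\varepsilon}(t,k)=\exp\big(\tfrac{\mathrm it}{\varepsilon}\Lambda_j(\varepsilon k)\big)\Psi_j(\varepsilon k)^*.$$ Let $P(w_1,\dots,w_n)^T=(w_1,0,\dots,0)^T$, $P^\perp=I-P$, and $\mathcal P_\varepsilon(k)=\psi_1(\kappa+\varepsilon k)\psi_1(\kappa+\varepsilon k)^*$. **Proposition 1.** Under Assumptions 1 and 2, for every sufficiently large $r>0$ there is $t_\star\in(0,t_{\rm end}]$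 such that for all $\varepsilon\in(0,1]$ and all $t\in[0,t_\star/\varepsilon]$ $$2\|Pz_1(t)\|_{L^1}+\tfrac2\varepsilon\|P^\perp z_1(t)\|_{L^1}+\tfrac2\varepsilon\|z_3(t)\|_{L^1}\le r,$$ and therefore also $\|(I-\mathcal P_\varepsilon)\widehat u_1(t)\|_{L^1}\le\tfrac r2\varepsilon$ and $\|u_3(t)\|_W\le\tfrac r2\varepsilon$. Besides $d$ and $n$, the threshold for $r$ depends only on $t_{\rm end}$ and on upper bounds for $\|p\|_{W^1}$, for $C_T$, for the inverses $|\lambda_{j\ell}(0)|^{-1}$ of the nonzero eigenvalues of $\Lambda_1(0)$ and $\Lambda_3(0)$, and for the Lipschitz constant $K$; $t_\star$ depends only on these and on $r$. In particular neither depends on $\varepsilon$. -/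

import Mathlib

open MeasureTheory Set Complex
open scoped ENNReal

noncomputable section

/-- `ℝ^d`: physical space and Fourier space. -/
abbrev Rd (d : ℕ) := EuclideanSpace ℝ (Fin d)

/-- `ℂ^n` with the Euclidean norm `|·|₂`. -/
abbrev Cn (n : ℕ) := EuclideanSpace ℂ (Fin n)

/-- The coefficients of `∂ₜu + A(∂)u + ε⁻¹ E u = ε T(u,u,u)`: symmetric `A₁, …, A_d`,
skew-symmetric `E`, and a real trilinear map `T`. -/
structure HypSystem (d n : ℕ) where
  A : Fin d → Matrix (Fin n) (Fin n) ℝ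
  A_symm : ∀ l, (A l).IsSymm
  E : Matrix (Fin n) (Fin n) ℝ
  E_skew : E.transpose = -E
  T : EuclideanSpace ℝ (Fin n) →ₗ[ℝ] EuclideanSpace ℝ (Fin n) →ₗ[ℝ]
    EuclideanSpace ℝ (Fin n) →ₗ[ℝ] EuclideanSpace ℝ (Fin n)

namespace HypSystem

variable {d n : ℕ} (Q : HypSystem d n)

/-- `L(α, β) = -α I + ∑ β_l A_l - i E`. -/
def L (α : ℝ) (β : Rd d) : Matrix (Fin n) (Fin n) ℂ :=
  -(α : ℂ) • (1 : Matrix (Fin n) (Fin n) ℂ)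
    + ∑ l, (β l : ℂ) • (Q.A l).map Complex.ofReal
    - Complex.I • Q.E.map Complex.ofReal

/-- The trilinear extension of `T` to `ℂ^n`: `∑ aᵢ bⱼ cₖ T(eᵢ, eⱼ, eₖ)`. -/
def TC (a b c : Cn n) : Cn n :=
  WithLp.toLp 2 fun m => ∑ i, ∑ j, ∑ k, a i * b j * c k *
    ((Q.T (EuclideanSpace.single i 1) (EuclideanSpace.single j 1)
      (EuclideanSpace.single k 1) m : ℝ) : ℂ)

end HypSystem

/-- The Wiener algebra `W` of `ℂ^n`-valued functions on `ℝ^d` whose Fourier transform is in `L¹`.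
An element `f` is stored as its Fourier transform `f̂ ∈ L¹(ℝ^d, ℂ^n)`, so that the norm of this
type is `‖f‖_W = ‖f̂‖_{L¹}`; the function `f` itself is `Wiener.eval f`. -/
abbrev Wiener (d n : ℕ) : Type := Lp (Cn n) 1 (volume : Measure (Rd d))

namespace Wiener

variable {d n : ℕ}

/-- The value `f(x) = (2π)^{-d/2} ∫ f̂(k) e^{i k·x} dk`. -/
def eval (f : Wiener d n) (x : Rd d) : Cn n :=
  ((2 * Real.pi) ^ (-(d : ℝ) / 2) : ℝ) •
    ∫ k : Rd d, Complex.exp (Complex.I * ((inner ℝ k x : ℝ) : ℂ)) • f k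

/-- `g = ∂_l f`, where `f, g ∈ W`. -/
def IsPartial (l : Fin d) (f g : Wiener d n) : Prop :=
  ∀ x, HasLineDerivAt ℝ (eval f) (eval g x) x (EuclideanSpace.single l 1)

/-- `f ∈ W¹`: all first partial derivatives of `f ∈ W` are in `W`. -/
def MemW1 (f : Wiener d n) : Prop := ∀ l, ∃ g : Wiener d n, IsPartial l f g

open Classical in
/-- `∂_l f` as an element of `W` (and `0` if `∂_l f` is not in `W`). -/
def partialD (l : Fin d) (f : Wiener d n) : Wiener d n :=
  if h : ∃ g : Wiener d n, IsPartial l f g then h.choose else 0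

/-- `‖f‖_{W¹} = ‖f‖_W + ∑ ‖∂_l f‖_W`, for `f ∈ W¹`. -/
def normW1 (f : Wiener d n) : ℝ := ‖f‖ + ∑ l, ‖partialD l f‖

end Wiener

/-- The index set `{±1, ±3}`. -/
def harmonics : Finset ℤ := {1, -1, 3, -3}

/-- All `(j₁, j₂, j₃)` with entries in `{±1, ±3}` and `j₁ + j₂ + j₃ = j`. -/
def triads (j : ℤ) : Finset (ℤ × ℤ × ℤ) :=
  (harmonics ×ˢ harmonics ×ˢ harmonics).filter fun J => J.1 + J.2.1 + J.2.2 = j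

/-- Entrywise complex conjugation. -/
def conjVec {n : ℕ} (v : Cn n) : Cn n := WithLp.toLp 2 fun m => starRingEnd ℂ (v m)

/-- `u_j(x)` for `j ∈ {±1, ±3}`, with `u_{-j} = conj u_j`. -/
def modeVal {d n : ℕ} (u₁ u₃ : Wiener d n) (j : ℤ) (x : Rd d) : Cn n :=
  if j = 1 then Wiener.eval u₁ x
  else if j = 3 then Wiener.eval u₃ x
  else if j = -1 then conjVec (Wiener.eval u₁ x)
  else if j = -3 then conjVec (Wiener.eval u₃ x)
  else 0

section Solution

variable {d n : ℕ}

/-- `∂ₜu_j + (i/ε) L(jω, jκ) u_j + A(∂) u_j = ε ∑_{j₁+j₂+j₃=j} T(u_{j₁}, u_{j₂}, u_{j₃})` at `x`,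
where `w` is `u_j` and `w'` is `∂ₜu_j`, at a fixed time. -/
def EnvelopeEq (Q : HypSystem d n) (κ : Rd d) (ω ε : ℝ) (u₁ u₃ : Wiener d n)
    (j : ℤ) (w w' : Wiener d n) (x : Rd d) : Prop :=
  Wiener.eval w' x
    + (Complex.I / (ε : ℂ)) • Matrix.toEuclideanLin (Q.L (j * ω) ((j : ℝ) • κ)) (Wiener.eval w x)
    + ∑ l, Matrix.toEuclideanLin ((Q.A l).map Complex.ofReal)
        (lineDeriv ℝ (Wiener.eval w) x (EuclideanSpace.single l 1))
  = (ε : ℂ) • ∑ J ∈ triads j,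
      Q.TC (modeVal u₁ u₃ J.1 x) (modeVal u₁ u₃ J.2.1 x) (modeVal u₁ u₃ J.2.2 x)

/-- `w ∈ C¹([0,τ], W) ∩ C([0,τ], W¹)`. -/
structure ClassicalRegularity (τ : ℝ) (w : ℝ → Wiener d n) : Prop where
  contDiffOn : ContDiffOn ℝ 1 w (Icc 0 τ)
  memW1 : ∀ t ∈ Icc 0 τ, Wiener.MemW1 (w t)
  continuousOn_partial : ∀ l, ContinuousOn (fun t => Wiener.partialD l (w t)) (Icc 0 τ)

/-- `(u₁, u₃)` is a classical solution on `[0, τ]` of the envelope system with initial data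
`u₁(0) = p`, `u₃(0) = 0`. -/
structure IsClassicalSolution (Q : HypSystem d n) (κ : Rd d) (ω ε τ : ℝ) (p : Wiener d n)
    (u₁ u₃ : ℝ → Wiener d n) : Prop where
  regular₁ : ClassicalRegularity τ u₁
  regular₃ : ClassicalRegularity τ u₃
  eq₁ : ∀ t ∈ Ioc 0 τ, ∀ x,
    EnvelopeEq Q κ ω ε (u₁ t) (u₃ t) 1 (u₁ t) (derivWithin u₁ (Icc 0 τ) t) x
  eq₃ : ∀ t ∈ Ioc 0 τ, ∀ x,
    EnvelopeEq Q κ ω ε (u₁ t) (u₃ t) 3 (u₃ t) (derivWithin u₃ (Icc 0 τ) t) x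
  init₁ : u₁ 0 = p
  init₃ : u₃ 0 = 0

/-- One-dimensional kernel of `L(ω, κ)`, polarized initial data, and invertibility of
`L(3ω, 3κ)` and `L(5ω, 5κ)`. -/
structure PolarizationAssumption (Q : HypSystem d n) (κ : Rd d) (ω : ℝ) (p : Wiener d n) :
    Prop where
  ker_dim : Module.finrank ℂ (LinearMap.ker (Matrix.toEuclideanLin (Q.L ω κ))) = 1
  polarized : ∀ x, Wiener.eval p x ∈ LinearMap.ker (Matrix.toEuclideanLin (Q.L ω κ))
  invertible₃ : IsUnit (Q.L (3 * ω) ((3 : ℝ) • κ))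
  invertible₅ : IsUnit (Q.L (5 * ω) ((5 : ℝ) • κ))

/-- `L(0, β) ψ_ℓ(β) = λ_ℓ(β) ψ_ℓ(β)` is an orthonormal eigendecomposition for every `β` which is
smooth away from `β = 0`, and the eigenvalues are globally Lipschitz with constant `K` with respect
to `|·|₁`. -/
structure SmoothEigendecomposition (Q : HypSystem d n) (K : ℝ)
    (lam : Fin n → Rd d → ℝ) (psi : Fin n → Rd d → Cn n) : Prop where
  eigen : ∀ ℓ β, Matrix.toEuclideanLin (Q.L 0 β) (psi ℓ β) = (lam ℓ β : ℂ) • psi ℓ β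
  orthonormal : ∀ β, Orthonormal ℂ fun ℓ => psi ℓ β
  smooth_lam : ∀ ℓ, ContDiffOn ℝ ((⊤ : ℕ∞) : WithTop ℕ∞) (lam ℓ) {0}ᶜ
  smooth_psi : ∀ ℓ, ContDiffOn ℝ ((⊤ : ℕ∞) : WithTop ℕ∞) (psi ℓ) {0}ᶜ
  lipschitz : ∀ ℓ β β', |lam ℓ β' - lam ℓ β| ≤ K * ∑ l, |β' l - β l|

/-- The eigenvalue `λ_{jℓ}(θ) = λ_ℓ(jκ + θ) - jω` of `L_j(θ) = L(jω, jκ + θ)`. -/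
def lamJ (κ : Rd d) (ω : ℝ) (lam : Fin n → Rd d → ℝ) (j : ℕ) (ℓ : Fin n) (θ : Rd d) : ℝ :=
  lam ℓ ((j : ℝ) • κ + θ) - j * ω

/-- The unitary matrix `Ψ_j(θ)`, with columns the eigenvectors `ψ_ℓ(jκ + θ)` of `L_j(θ)`. -/
def PsiJ (κ : Rd d) (psi : Fin n → Rd d → Cn n) (j : ℕ) (θ : Rd d) :
    Matrix (Fin n) (Fin n) ℂ :=
  Matrix.of fun m ℓ => psi ℓ ((j : ℝ) • κ + θ) m

/-- `S_{j,ε}(t,k) = exp((it/ε) Λ_j(εk)) Ψ_j(εk)*`. -/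
def SJ (κ : Rd d) (ω : ℝ) (lam : Fin n → Rd d → ℝ) (psi : Fin n → Rd d → Cn n)
    (j : ℕ) (ε t : ℝ) (k : Rd d) : Matrix (Fin n) (Fin n) ℂ :=
  Matrix.diagonal (fun ℓ => Complex.exp (Complex.I * (t / ε * lamJ κ ω lam j ℓ (ε • k) : ℝ)))
    * (PsiJ κ psi j (ε • k)).conjTranspose

/-- The transformed variable `z_j(t,k) = S_{j,ε}(t,k) û_j(t,k)`, where `w = u_j(t)`. -/
def zJ (κ : Rd d) (ω : ℝ) (lam : Fin n → Rd d → ℝ) (psi : Fin n → Rd d → Cn n)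
    (j : ℕ) (ε t : ℝ) (w : Wiener d n) (k : Rd d) : Cn n :=
  Matrix.toEuclideanLin (SJ κ ω lam psi j ε t k) (w k)

/-- The projection `P` of `ℂ^n` that keeps the entry with index `ℓ₁` and annihilates the others. -/
def coordProj (ℓ₁ : Fin n) (w : Cn n) : Cn n := EuclideanSpace.single ℓ₁ (w ℓ₁)

/-- The scaled norm `2‖P y₁‖_{L¹} + (2/ε)‖P^⊥ y₁‖_{L¹} + (2/ε)‖y₃‖_{L¹}`. -/
def scaledNorm (ℓ₁ : Fin n) (ε : ℝ) (y₁ y₃ : Rd d → Cn n) : ℝ≥0∞ :=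
  2 * eLpNorm (fun k => coordProj ℓ₁ (y₁ k)) 1 volume
    + ENNReal.ofReal (2 / ε) * eLpNorm (fun k => y₁ k - coordProj ℓ₁ (y₁ k)) 1 volume
    + ENNReal.ofReal (2 / ε) * eLpNorm y₃ 1 volume

/-- `𝒫_ε(k) û(k) = ψ_{11}(εk) ψ_{11}(εk)* û(k)`, the orthogonal projection onto the distinguished
eigenspace of `L₁(εk)`. -/
def eigProj (κ : Rd d) (psi : Fin n → Rd d → Cn n) (ℓ₁ : Fin n) (ε : ℝ)
    (w : Rd d → Cn n) (k : Rd d) : Cn n :=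
  (inner ℂ (psi ℓ₁ (κ + ε • k)) (w k) : ℂ) • psi ℓ₁ (κ + ε • k)

end Solution

end

/-! In Fourier space the component of `û_j` along `ψ_ℓ(jκ + εk)` solves a scalar equation `∂ₜa +
iφ(k)a = f`, where `φ(k) = λ_{jℓ}(εk)/ε` is real and `f` is the same component of `ε` times the
nonlinearity (`SmoothEigendecomposition.projW_eq`). A real phase does not change moduli, so the `L¹`
norm of `a` grows at most at the rate `‖f‖` (`norm_le_of_transport`), however large `φ` is. The
entries of `z_j` have the moduli of these components, so the estimates are made for the components
and carried over to `z_j` only at the end.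

Uniform `W¹` bound. The multiplier `k_l` commutes with the spectral projections, hence derivatives
obey the same estimate. The forcing is `O(ε)` in `W¹` and acts for a time at most `t_⋆/ε`; a
continuity argument gives a bound `B` independent of `ε` when `t_⋆` is small
(`IsClassicalSolution.normW1_lt`).

Nonresonant components. Here `λ_{jℓ}(0) ≠ 0`, and one more power of `ε` is gained by a normal form
(`SmoothEigendecomposition.norm_projW_le_of_nonresonant`). In the nonlinearity, `u₁` is replaced by
its resonant part `v` and `u₃` by `0`; the error is controlled by the remainder, that is, by the
nonresonant components themselves. The Lipschitz bound on `λ₁` makes the frequency of `v` at most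
`K|k|₁`, without a factor `1/ε`, so `∂ₜv = O(1)` at the price of one space derivative. The forcing
`εb` built from `v` is thus slow, whereas the component it drives rotates with frequency close to
`λ_{jℓ}(0)/ε`. Subtracting `μb` with `μ = ε²/(iλ_{jℓ}(0))` cancels it and leaves a forcing `O(ε²)`,
which contributes `O(ε)` over times `O(1/ε)`.

Initially `u₃` vanishes, and the nonresonant part of `p` is `O(ε)` because `L(ω, κ)p̂ = 0`
(`SmoothEigendecomposition.norm_projW_initial_le`). If the remainder is at most `Yε`, the
replacement error contributes a multiple of `t_⋆Yε`, so a second continuity argument closes for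
small `t_⋆` (`IsClassicalSolution.remainder_lt`). -/

section FourierUniqueness

/-! ### Uniqueness of the Fourier transform on `L¹`. -/

open FourierTransform SchwartzMap
open scoped ContDiff

/-- An integrable function whose Fourier transform vanishes identically is zero a.e. -/
theorem ae_eq_zero_of_fourier_eq_zero {V F : Type*} [NormedAddCommGroup V]
    [InnerProductSpace ℝ V] [FiniteDimensional ℝ V] [MeasurableSpace V] [BorelSpace V]
    [NormedAddCommGroup F] [NormedSpace ℂ F] [CompleteSpace F] {f : V → F}
    (hf : Integrable f) (h : ∀ ξ, 𝓕 f ξ = 0) : ∀ᵐ x, f x = 0 := by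
  refine ae_eq_zero_of_integral_contDiff_smul_eq_zero hf.locallyIntegrable fun g g_smooth g_cpt => ?_
  have hg₁ : HasCompactSupport (Complex.ofRealCLM ∘ g) := g_cpt.comp_left rfl
  have hg₂ : ContDiff ℝ ∞ (Complex.ofRealCLM ∘ g) := by fun_prop
  let φ : 𝓢(V, ℂ) := hg₁.toSchwartzMap hg₂
  -- Duality: the test function is the Fourier transform of `𝓕⁻ φ`, and in the pairing with `f` the
  -- transform can be moved onto `f`, where it vanishes.
  have key := VectorFourier.integral_fourierIntegral_smul_eq_flip (e := Real.fourierChar)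
    (L := innerₗ V) (μ := volume) (ν := volume) (f := (𝓕⁻ φ : 𝓢(V, ℂ))) (g := f)
    Real.continuous_fourierChar continuous_inner (𝓕⁻ φ : 𝓢(V, ℂ)).integrable hf
  have h1 : VectorFourier.fourierIntegral Real.fourierChar volume (innerₗ V)
      (𝓕⁻ φ : 𝓢(V, ℂ)) = φ := by
    have : 𝓕 ((𝓕⁻ φ : 𝓢(V, ℂ)) : V → ℂ) = φ := by
      rw [← fourier_coe]; simp
    exact this
  have h2 : ∀ ξ, VectorFourier.fourierIntegral Real.fourierChar volume (innerₗ V).flip f ξ = 0 := by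
    intro ξ; rw [flip_innerₗ]; exact h ξ
  rw [h1] at key
  simp only [h2, smul_zero, integral_zero] at key
  rw [← key]
  refine integral_congr_ae (.of_forall fun x => ?_)
  simp [φ]

end FourierUniqueness

/-! ### Evaluation of elements of `W`. -/

namespace Wiener

variable {d n : ℕ}

open FourierTransform

/-- The normalization constant `(2π)^{-d/2}`. -/
noncomputable def evalConst (d : ℕ) : ℝ := (2 * Real.pi) ^ (-(d : ℝ) / 2)

theorem evalConst_pos (d : ℕ) : 0 < evalConst d := by unfold evalConst; positivity

theorem integrable (f : Wiener d n) : Integrable f := L1.integrable_coeFn f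

/-- Change of normalization: `𝓕` has the kernel `e^{-2πi⟨k,ξ⟩}`, so `x` corresponds to `ξ =
-x/(2π)`. Uniqueness and the convolution theorem for `𝓕` are transferred to `eval` this way. -/
theorem eval_eq_fourier (f : Wiener d n) (x : Rd d) :
    eval f x = evalConst d • 𝓕 (f : Rd d → Cn n) (-((2 * Real.pi)⁻¹ • x)) := by
  unfold eval evalConst
  congr 1
  rw [Real.fourier_eq']
  congr 1 with k : 1
  congr 2
  rw [inner_neg_right, inner_smul_right]
  push_cast
  have : (Real.pi : ℂ) ≠ 0 := by exact_mod_cast Real.pi_ne_zero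
  field_simp

theorem integrable_exp_smul {E : Type*} [NormedAddCommGroup E] [NormedSpace ℂ E]
    {f : Rd d → E} (hf : Integrable f) (x : Rd d) :
    Integrable fun k => Complex.exp (Complex.I * ((inner ℝ k x : ℝ) : ℂ)) • f k := by
  refine hf.mono ?_ (.of_forall fun k => ?_)
  · exact (by fun_prop : Continuous fun k : Rd d =>
      Complex.exp (Complex.I * ((inner ℝ k x : ℝ) : ℂ))).aestronglyMeasurable.smul
      hf.aestronglyMeasurable
  · rw [norm_smul, mul_comm Complex.I, Complex.norm_exp_ofReal_mul_I, one_mul]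

/-- `f ∈ W` is determined by its values. -/
theorem eq_zero_of_eval_eq_zero {f : Wiener d n} (h : ∀ x, eval f x = 0) : f = 0 := by
  rw [Lp.eq_zero_iff_ae_eq_zero]
  refine ae_eq_zero_of_fourier_eq_zero (integrable f) fun ξ => ?_
  have := h (-((2 * Real.pi) • ξ))
  rw [eval_eq_fourier, smul_eq_zero_iff_right (evalConst_pos d).ne', smul_neg, neg_neg, smul_smul,
    inv_mul_cancel₀ (by positivity), one_smul] at this
  exact this

theorem eval_congr_ae {f : Wiener d n} {g : Rd d → Cn n} (h : f =ᵐ[volume] g) (x : Rd d) :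
    eval f x = evalConst d • ∫ k : Rd d, Complex.exp (Complex.I * ((inner ℝ k x : ℝ) : ℂ)) • g k := by
  unfold eval evalConst
  congr 1
  exact integral_congr_ae (h.mono fun k hk => by simp only [hk])

theorem eval_add (f g : Wiener d n) (x : Rd d) : eval (f + g) x = eval f x + eval g x := by
  rw [eval_congr_ae (Lp.coeFn_add f g)]
  simp only [Pi.add_apply, smul_add]
  rw [integral_add (integrable_exp_smul (integrable f) x) (integrable_exp_smul (integrable g) x),
    smul_add]
  rfl

theorem eval_smul (c : ℂ) (f : Wiener d n) (x : Rd d) : eval (c • f) x = c • eval f x := by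
  rw [eval_congr_ae (Lp.coeFn_smul c f)]
  simp only [Pi.smul_apply]
  simp_rw [smul_comm _ c]
  rw [integral_smul, smul_comm]
  rfl

/-- Evaluation at `x` as a linear map. -/
noncomputable def evalₗ (x : Rd d) : Wiener d n →ₗ[ℂ] Cn n where
  toFun f := eval f x
  map_add' f g := eval_add f g x
  map_smul' c f := eval_smul c f x

theorem evalₗ_apply (x : Rd d) (f : Wiener d n) : evalₗ x f = eval f x := rfl

theorem eval_injective {f g : Wiener d n} (h : ∀ x, eval f x = eval g x) : f = g := by
  refine sub_eq_zero.1 (eq_zero_of_eval_eq_zero fun x => ?_)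
  rw [← evalₗ_apply, map_sub, evalₗ_apply, evalₗ_apply, h, sub_self]

theorem eval_compLp (L : Cn n →L[ℂ] Cn n) (f : Wiener d n) (x : Rd d) :
    eval (L.compLp f) x = L (eval f x) := by
  rw [eval_congr_ae (L.coeFn_compLp f)]
  simp_rw [← map_smul]
  rw [L.integral_comp_comm (integrable_exp_smul (integrable f) x)]
  unfold eval evalConst
  rw [← Complex.coe_smul, ← Complex.coe_smul, map_smul]

end Wiener

/-! ### Partial derivatives as Fourier multipliers. -/

namespace Wiener

variable {d n : ℕ}

/-- `g = ∂_l f` on the Fourier side: `ĝ(k) = i k_l f̂(k)`. -/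
def IsDer (l : Fin d) (f g : Wiener d n) : Prop :=
  ∀ᵐ k : Rd d, g k = (Complex.I * (k l : ℂ)) • f k

theorem ae_eq_zero_of_integral_exp_smul_eq_zero {f : Rd d → Cn n} (hf : Integrable f)
    (h : ∀ x : Rd d, ∫ k : Rd d, Complex.exp (Complex.I * ((inner ℝ k x : ℝ) : ℂ)) • f k = 0) :
    ∀ᵐ k, f k = 0 := by
  have h0 : hf.toL1 f = 0 := eq_zero_of_eval_eq_zero fun x => by
    rw [eval_congr_ae hf.coeFn_toL1, h, smul_zero]
  filter_upwards [hf.coeFn_toL1, Lp.eq_zero_iff_ae_eq_zero.1 h0] with k h1 h2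
  rw [← h1, h2, Pi.zero_apply]

theorem continuous_eval (f : Wiener d n) : Continuous (eval f) := by
  unfold eval
  refine Continuous.const_smul (M := ℝ) ?_ _
  refine continuous_of_dominated (bound := fun k => ‖f k‖)
    (fun x => (integrable_exp_smul (integrable f) x).aestronglyMeasurable)
    (fun x => .of_forall fun k => ?_) (integrable f).norm (.of_forall fun k => by fun_prop)
  rw [norm_smul, mul_comm Complex.I, Complex.norm_exp_ofReal_mul_I, one_mul]

theorem exp_inner_add_single (k x : Rd d) (l : Fin d) (s : ℝ) :
    Complex.exp (Complex.I * ((inner ℝ k (x + s • EuclideanSpace.single l 1) : ℝ) : ℂ)) =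
      Complex.exp (Complex.I * ((inner ℝ k x : ℝ) : ℂ)) *
        Complex.exp (Complex.I * (k l : ℂ) * (s : ℂ)) := by
  rw [← Complex.exp_add, inner_add_right, inner_smul_right, EuclideanSpace.inner_single_right]
  congr 1
  simp
  ring

theorem IsPartial.eval_sub {l : Fin d} {f g : Wiener d n} (h : IsPartial l f g) (x : Rd d) (t : ℝ) :
    eval f (x + t • EuclideanSpace.single l 1) - eval f x
      = ∫ s in (0 : ℝ)..t, eval g (x + s • EuclideanSpace.single l 1) := by
  have hd : ∀ s : ℝ, HasDerivAt (fun s : ℝ => eval f (x + s • EuclideanSpace.single l 1))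
      (eval g (x + s • EuclideanSpace.single l 1)) s := by
    intro s
    have h1 : HasDerivAt (fun r : ℝ => eval f (x + s • EuclideanSpace.single l (1 : ℝ)
        + r • EuclideanSpace.single l 1)) (eval g (x + s • EuclideanSpace.single l 1)) (s - s) := by
      rw [sub_self]
      exact h (x + s • EuclideanSpace.single l 1)
    have h2 := h1.comp_sub_const s s
    refine h2.congr_of_eventuallyEq (.of_forall fun r => ?_)
    simp only [add_assoc, ← add_smul]
    congr 3
    ring
  rw [intervalIntegral.integral_eq_sub_of_hasDerivAt (fun s _ => hd s)]
  · simp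
  · exact ((continuous_eval g).comp (by fun_prop)).intervalIntegrable _ _

theorem integral_exp_mul_norm_le (y t : ℝ) :
    ‖∫ s in (0 : ℝ)..t, Complex.exp (Complex.I * (y : ℂ) * (s : ℂ))‖ ≤ |t| := by
  have := intervalIntegral.norm_integral_le_of_norm_le_const (a := 0) (b := t) (C := 1)
    (f := fun s : ℝ => Complex.exp (Complex.I * (y : ℂ) * (s : ℂ))) fun s _ => by
      rw [show Complex.I * (y : ℂ) * (s : ℂ) = ((y * s : ℝ) : ℂ) * Complex.I by push_cast; ring,
        Complex.norm_exp_ofReal_mul_I]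
  simpa using this

theorem integral_eval_add_single (g : Wiener d n) (l : Fin d) (x : Rd d) (t : ℝ) :
    ∫ s in (0 : ℝ)..t, eval g (x + s • EuclideanSpace.single l 1)
      = evalConst d • ∫ k : Rd d, Complex.exp (Complex.I * ((inner ℝ k x : ℝ) : ℂ)) •
          (∫ s in (0 : ℝ)..t, Complex.exp (Complex.I * (k l : ℂ) * (s : ℂ))) • g k := by
  unfold eval
  rw [intervalIntegral.integral_smul]
  congr 1
  rw [intervalIntegral_integral_swap]
  · refine integral_congr_ae (.of_forall fun k => ?_)
    simp only [exp_inner_add_single, mul_smul]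
    rw [intervalIntegral.integral_smul, intervalIntegral.integral_smul_const]
  · have : IsFiniteMeasure (volume.restrict (uIoc 0 t)) :=
      ⟨by rw [Measure.restrict_apply_univ, Set.uIoc]; exact measure_Ioc_lt_top⟩
    have hg : Integrable (fun z : ℝ × Rd d => g z.2)
        ((volume.restrict (uIoc 0 t)).prod volume) := (integrable g).comp_snd _
    refine hg.mono ?_ (.of_forall fun z => ?_)
    · exact (by fun_prop : Continuous fun z : ℝ × Rd d => Complex.exp (Complex.I *
        ((inner ℝ z.2 (x + z.1 • EuclideanSpace.single l 1) : ℝ) : ℂ))).aestronglyMeasurable.smul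
        hg.aestronglyMeasurable
    · simp only [Function.uncurry]
      rw [norm_smul, mul_comm Complex.I, Complex.norm_exp_ofReal_mul_I, one_mul]

/-- It is not known beforehand that `k_l f̂` is integrable, so the derivative is first replaced by
the increment over `[0, t]`. Both multipliers are then bounded, and uniqueness of the Fourier
transform applies. -/
theorem IsPartial.ae_increment {l : Fin d} {f g : Wiener d n} (h : IsPartial l f g) (t : ℝ) :
    ∀ᵐ k : Rd d, (Complex.exp (Complex.I * (k l : ℂ) * (t : ℂ)) - 1) • f k
      = (∫ s in (0 : ℝ)..t, Complex.exp (Complex.I * (k l : ℂ) * (s : ℂ))) • g k := by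
  have hcont : Continuous fun k : Rd d =>
      ∫ s in (0 : ℝ)..t, Complex.exp (Complex.I * (k l : ℂ) * (s : ℂ)) :=
    intervalIntegral.continuous_parametric_intervalIntegral_of_continuous' (by fun_prop) _ _
  have hf' : Integrable fun k : Rd d =>
      (Complex.exp (Complex.I * (k l : ℂ) * (t : ℂ)) - 1) • f k := by
    refine (integrable f).bdd_smul 2
      (by fun_prop : Continuous fun k : Rd d =>
        Complex.exp (Complex.I * (k l : ℂ) * (t : ℂ)) - 1).aestronglyMeasurable
      (.of_forall fun k => ?_)
    refine (norm_sub_le _ _).trans ?_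
    rw [show Complex.I * (k l : ℂ) * (t : ℂ) = ((k l * t : ℝ) : ℂ) * Complex.I by push_cast; ring,
        Complex.norm_exp_ofReal_mul_I, norm_one]
    norm_num
  have hg' : Integrable fun k : Rd d =>
      (∫ s in (0 : ℝ)..t, Complex.exp (Complex.I * (k l : ℂ) * (s : ℂ))) • g k :=
    (integrable g).bdd_smul |t| hcont.aestronglyMeasurable
      (.of_forall fun k => integral_exp_mul_norm_le _ _)
  have key := ae_eq_zero_of_integral_exp_smul_eq_zero (hf'.sub hg') fun x => by
    have e := h.eval_sub x t
    rw [integral_eval_add_single] at e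
    have e1 : eval f (x + t • EuclideanSpace.single l 1) - eval f x = evalConst d •
        ∫ k : Rd d, Complex.exp (Complex.I * ((inner ℝ k x : ℝ) : ℂ)) •
          (Complex.exp (Complex.I * (k l : ℂ) * (t : ℂ)) - 1) • f k := by
      unfold eval evalConst
      rw [← smul_sub, ← integral_sub (integrable_exp_smul (integrable f) _)
        (integrable_exp_smul (integrable f) _)]
      congr 2 with k : 1
      rw [exp_inner_add_single, smul_smul, mul_sub, sub_smul, mul_one]
    rw [e1] at e
    have e2 := smul_right_injective _ (evalConst_pos d).ne' e
    simp only [Pi.sub_apply, smul_sub]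
    rw [integral_sub (integrable_exp_smul hf' x) (integrable_exp_smul hg' x)]
    exact sub_eq_zero.2 e2
  filter_upwards [key] with k hk
  exact sub_eq_zero.1 hk

/-- A partial derivative in `W` is given by the Fourier multiplier `i k_l`. -/
theorem IsPartial.isDer {l : Fin d} {f g : Wiener d n} (h : IsPartial l f g) : IsDer l f g := by
  -- The exceptional null set depends on `t`, so only the countably many values `t = 1/(m+1)` are
  -- used; dividing by `t` and letting `m → ∞` turns increments into derivatives at `0`.
  have hall : ∀ᵐ k : Rd d, ∀ m : ℕ, _ := ae_all_iff.2 fun m : ℕ => h.ae_increment (1 / ((m : ℝ) + 1))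
  filter_upwards [hall] with k hk
  have hseq : Filter.Tendsto (fun m : ℕ => 1 / ((m : ℝ) + 1)) Filter.atTop (nhdsWithin 0 {0}ᶜ) :=
    tendsto_nhdsWithin_iff.2 ⟨tendsto_one_div_add_atTop_nhds_zero_nat,
      .of_forall fun m => (by positivity : (1 : ℝ) / ((m : ℝ) + 1) ≠ 0)⟩
  have hexp : HasDerivAt (fun t : ℝ => Complex.exp (Complex.I * (k l : ℂ) * (t : ℂ)))
      (Complex.I * (k l : ℂ)) 0 := by
    have h0 : HasDerivAt (fun t : ℂ => Complex.exp (Complex.I * (k l : ℂ) * t))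
        (Complex.exp (Complex.I * (k l : ℂ) * ((0 : ℝ) : ℂ)) * (Complex.I * (k l : ℂ) * 1))
        ((0 : ℝ) : ℂ) :=
      ((hasDerivAt_id _).const_mul _).cexp
    simpa using h0.comp_ofReal
  have h1 : HasDerivAt (fun t : ℝ => (Complex.exp (Complex.I * (k l : ℂ) * (t : ℂ)) - 1) • f k)
      ((Complex.I * (k l : ℂ)) • f k) 0 := (hexp.sub_const 1).smul_const (f k)
  have h2 : HasDerivAt (fun t : ℝ =>
      (∫ s in (0 : ℝ)..t, Complex.exp (Complex.I * (k l : ℂ) * (s : ℂ))) • g k) (g k) 0 := by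
    have hc : Continuous fun s : ℝ => Complex.exp (Complex.I * (k l : ℂ) * (s : ℂ)) := by fun_prop
    have := (hc.integral_hasStrictDerivAt 0 0).hasDerivAt.smul_const (g k)
    simpa using this
  have t1 := (hasDerivAt_iff_tendsto_slope.1 h1).comp hseq
  have t2 := (hasDerivAt_iff_tendsto_slope.1 h2).comp hseq
  refine tendsto_nhds_unique (t2.congr fun m => ?_) t1
  simp only [Function.comp_apply, slope_def_module]
  rw [← hk m]
  simp

theorem MemW1.isPartial_partialD {f : Wiener d n} (h : MemW1 f) (l : Fin d) :
    IsPartial l f (partialD l f) := by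
  unfold partialD
  rw [dif_pos (h l)]
  exact (h l).choose_spec

theorem MemW1.isDer_partialD {f : Wiener d n} (h : MemW1 f) (l : Fin d) :
    IsDer l f (partialD l f) := (h.isPartial_partialD l).isDer

theorem MemW1.lineDeriv_eval {f : Wiener d n} (h : MemW1 f) (l : Fin d) (x : Rd d) :
    lineDeriv ℝ (eval f) x (EuclideanSpace.single l 1) = eval (partialD l f) x :=
  (h.isPartial_partialD l x).lineDeriv

end Wiener

/-! ### Vector-valued convolution on `L¹`. -/

section ConvolutionOperator

open scoped Convolution

variable {V E F G : Type*} [NormedAddCommGroup V] [InnerProductSpace ℝ V] [FiniteDimensional ℝ V]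
  [MeasurableSpace V] [BorelSpace V]
  [NormedAddCommGroup E] [NormedSpace ℂ E] [NormedAddCommGroup F] [NormedSpace ℂ F]
  [NormedAddCommGroup G] [NormedSpace ℂ G]

/-- Young's inequality for `L¹ ⋆ L¹`. -/
theorem integral_norm_convolution_le (B : E →L[ℂ] F →L[ℂ] G) {f : V → E} {g : V → F}
    (hf : Integrable f) (hg : Integrable g) :
    ∫ x, ‖(f ⋆[B] g) x‖ ≤ ‖B‖ * (∫ x, ‖f x‖) * ∫ x, ‖g x‖ := by
  have h := integral_convolution (ContinuousLinearMap.mul ℝ ℝ) hf.norm hg.norm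
  simp only [ContinuousLinearMap.mul_apply'] at h
  rw [mul_assoc, ← h, ← integral_const_mul]
  refine integral_mono_ae (hf.integrable_convolution B hg).norm
    ((hf.norm.integrable_convolution (.mul ℝ ℝ) hg.norm).const_mul _) ?_
  filter_upwards [hf.norm.ae_convolution_exists (.mul ℝ ℝ) hg.norm] with x hx
  simp only [convolution_def]
  rw [← integral_const_mul]
  refine norm_integral_le_of_norm_le (Integrable.const_mul hx _) (.of_forall fun t => ?_)
  simpa [mul_assoc] using B.le_opNorm₂ (f t) (g (x - t))

/-- Convolution as a continuous bilinear map on `L¹`. -/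
noncomputable def convL1 (B : E →L[ℂ] F →L[ℂ] G) :
    Lp E 1 (volume : Measure V) →L[ℂ] Lp F 1 (volume : Measure V) →L[ℂ]
      Lp G 1 (volume : Measure V) :=
  LinearMap.mkContinuous₂
    (LinearMap.mk₂ ℂ
      (fun f g => ((L1.integrable_coeFn f).integrable_convolution B (L1.integrable_coeFn g)).toL1 _)
      (fun f f' g => by
        rw [← Integrable.toL1_add, Integrable.toL1_eq_toL1_iff,
          convolution_congr B (Lp.coeFn_add f f') .rfl]
        filter_upwards [(L1.integrable_coeFn f).ae_convolution_exists B (L1.integrable_coeFn g),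
          (L1.integrable_coeFn f').ae_convolution_exists B (L1.integrable_coeFn g)] with x h1 h2
        exact h1.add_distrib h2)
      (fun c f g => by
        rw [← Integrable.toL1_smul, Integrable.toL1_eq_toL1_iff,
          convolution_congr B (Lp.coeFn_smul c f) .rfl, smul_convolution]
        rfl)
      (fun f g g' => by
        rw [← Integrable.toL1_add, Integrable.toL1_eq_toL1_iff,
          convolution_congr B .rfl (Lp.coeFn_add g g')]
        filter_upwards [(L1.integrable_coeFn f).ae_convolution_exists B (L1.integrable_coeFn g),
          (L1.integrable_coeFn f).ae_convolution_exists B (L1.integrable_coeFn g')] with x h1 h2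
        exact h1.distrib_add h2)
      (fun c f g => by
        rw [← Integrable.toL1_smul, Integrable.toL1_eq_toL1_iff,
          convolution_congr B .rfl (Lp.coeFn_smul c g), convolution_smul]
        rfl))
    ‖B‖
    (fun f g => by
      rw [LinearMap.mk₂_apply, L1.norm_of_fun_eq_integral_norm, L1.norm_eq_integral_norm,
        L1.norm_eq_integral_norm]
      exact integral_norm_convolution_le B (L1.integrable_coeFn f) (L1.integrable_coeFn g))

theorem coeFn_convL1 (B : E →L[ℂ] F →L[ℂ] G) (f : Lp E 1 (volume : Measure V))
    (g : Lp F 1 (volume : Measure V)) : convL1 B f g =ᵐ[volume] f ⋆[B] g :=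
  ((L1.integrable_coeFn f).integrable_convolution B (L1.integrable_coeFn g)).coeFn_toL1

theorem norm_convL1_le (B : E →L[ℂ] F →L[ℂ] G) (f : Lp E 1 (volume : Measure V))
    (g : Lp F 1 (volume : Measure V)) : ‖convL1 B f g‖ ≤ ‖B‖ * ‖f‖ * ‖g‖ := by
  rw [L1.norm_eq_integral_norm, L1.norm_eq_integral_norm, L1.norm_eq_integral_norm,
    integral_congr_ae ((coeFn_convL1 B f g).mono fun x hx => congrArg norm hx)]
  exact integral_norm_convolution_le B (L1.integrable_coeFn f) (L1.integrable_coeFn g)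

theorem norm_convL1_le_of_bound (B : E →L[ℂ] F →L[ℂ] G) {C : ℝ} (hC : 0 ≤ C)
    (hB : ∀ a b, ‖B a b‖ ≤ C * ‖a‖ * ‖b‖) (f : Lp E 1 (volume : Measure V))
    (g : Lp F 1 (volume : Measure V)) : ‖convL1 B f g‖ ≤ C * ‖f‖ * ‖g‖ := by
  refine (norm_convL1_le B f g).trans ?_
  gcongr
  exact ContinuousLinearMap.opNorm_le_bound₂ _ hC hB

/-- Leibniz rule: multiplication by a linear functional is a derivation for the convolution. -/
theorem convL1_leibniz (B : E →L[ℂ] F →L[ℂ] G) (φ : V → ℂ) (hφ : ∀ x y, φ (x + y) = φ x + φ y)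
    {f f' : Lp E 1 (volume : Measure V)} {g g' : Lp F 1 (volume : Measure V)}
    (hf : ∀ᵐ k, f' k = φ k • f k) (hg : ∀ᵐ k, g' k = φ k • g k) :
    ∀ᵐ k, (convL1 B f' g + convL1 B f g' : Lp G 1 (volume : Measure V)) k
      = φ k • (convL1 B f g : Lp G 1 (volume : Measure V)) k := by
  have if' := L1.integrable_coeFn f'
  have ig' := L1.integrable_coeFn g'
  have cf : f' ⋆[B] g = (fun k => φ k • f k) ⋆[B] g := convolution_congr B hf .rfl
  have cg : f ⋆[B] g' = f ⋆[B] (fun k => φ k • g k) := convolution_congr B .rfl hg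
  filter_upwards [Lp.coeFn_add (convL1 B f' g) (convL1 B f g'), coeFn_convL1 B f' g,
    coeFn_convL1 B f g', coeFn_convL1 B f g,
    (if'.congr hf).ae_convolution_exists B (L1.integrable_coeFn g),
    (L1.integrable_coeFn f).ae_convolution_exists B (ig'.congr hg)] with k h1 h2 h3 h4 h5 h6
  rw [h1, Pi.add_apply, h2, h3, h4, cf, cg]
  simp only [convolution_def]
  rw [← integral_add h5 h6, ← integral_smul]
  refine integral_congr_ae (.of_forall fun t => ?_)
  have : φ k = φ t + φ (k - t) := by rw [← hφ]; congr 1; abel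
  simp only [map_smul, smul_apply]
  rw [this, add_smul]

end ConvolutionOperator

theorem Wiener.IsDer.const_smul {d n : ℕ} {l : Fin d} {f g : Wiener d n} (c : ℂ)
    (h : Wiener.IsDer l f g) : Wiener.IsDer l (c • f) (c • g) := by
  filter_upwards [h, Lp.coeFn_smul c f, Lp.coeFn_smul c g] with k h1 h2 h3
  rw [h2, h3, Pi.smul_apply, Pi.smul_apply, h1, smul_comm]

/-! ### The trilinear map on `W`. -/

namespace HypSystem

variable {d n : ℕ} (Q : HypSystem d n)

/-- The trilinear extension of `T` as a linear map in its last argument. -/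
noncomputable def TCLast (a b : Cn n) : Cn n →L[ℂ] Cn n :=
  LinearMap.toContinuousLinearMap
    { toFun := fun c => Q.TC a b c
      map_add' := fun c c' => by
        ext m; simp [TC, mul_add, add_mul, Finset.sum_add_distrib]
      map_smul' := fun s c => by
        ext m
        simp only [TC, PiLp.smul_apply, smul_eq_mul, RingHom.id_apply, Finset.mul_sum]
        refine Finset.sum_congr rfl fun i _ => Finset.sum_congr rfl fun j _ =>
          Finset.sum_congr rfl fun k _ => by ring }

theorem TCLast_apply (a b c : Cn n) : Q.TCLast a b c = Q.TC a b c := rfl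

/-- The trilinear extension of `T` as a linear map in its last two arguments. -/
noncomputable def TCMid (a : Cn n) : Cn n →L[ℂ] Cn n →L[ℂ] Cn n :=
  LinearMap.toContinuousLinearMap
    { toFun := Q.TCLast a
      map_add' := fun b b' => by
        ext c m
        simp [TCLast_apply, TC, add_mul, mul_add, Finset.sum_add_distrib]
      map_smul' := fun s b => by
        ext c m
        simp only [TCLast_apply, TC, PiLp.smul_apply, smul_eq_mul, Finset.mul_sum,
          smul_apply, RingHom.id_apply]
        refine Finset.sum_congr rfl fun i _ => Finset.sum_congr rfl fun j _ =>
          Finset.sum_congr rfl fun k _ => by ring }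

theorem TCMid_apply (a b c : Cn n) : Q.TCMid a b c = Q.TC a b c := rfl

/-- The trilinear extension of `T` as a continuous trilinear map. -/
noncomputable def TCL : Cn n →L[ℂ] Cn n →L[ℂ] Cn n →L[ℂ] Cn n :=
  LinearMap.toContinuousLinearMap
    { toFun := Q.TCMid
      map_add' := fun a a' => by
        ext b c m
        simp [TCMid_apply, TC, add_mul, Finset.sum_add_distrib]
      map_smul' := fun s a => by
        ext b c m
        simp only [TCMid_apply, TC, PiLp.smul_apply, smul_eq_mul, Finset.mul_sum,
          smul_apply, RingHom.id_apply]
        refine Finset.sum_congr rfl fun i _ => Finset.sum_congr rfl fun j _ =>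
          Finset.sum_congr rfl fun k _ => by ring }

theorem TCL_apply (a b c : Cn n) : Q.TCL a b c = Q.TC a b c := rfl

/-- `(f, g, h) ↦ T(f, g, h)` on `W`. -/
noncomputable def triW (f g h : Wiener d n) : Wiener d n :=
  ((Wiener.evalConst d : ℂ) ^ 2) •
    convL1 (ContinuousLinearMap.id ℂ (Cn n →L[ℂ] Cn n)) (convL1 Q.TCL f g) h

-- The convolution theorem is used twice, the outer bilinear map being application of an operator to
-- a vector. Three evaluations carry the constant `(2π)^{-d/2}` three times and the evaluated double
-- convolution only once, which explains the squared factor in `triW`.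
open FourierTransform in
theorem eval_triW (f g h : Wiener d n) (x : Rd d) :
    Wiener.eval (Q.triW f g h) x
      = Q.TC (Wiener.eval f x) (Wiener.eval g x) (Wiener.eval h x) := by
  rw [triW, Wiener.eval_smul]
  simp only [Wiener.eval_eq_fourier]
  set ξ := -((2 * Real.pi)⁻¹ • x)
  have fourier_congr : ∀ {E : Type} [NormedAddCommGroup E] [NormedSpace ℂ E] {a b : Rd d → E},
      a =ᵐ[volume] b → 𝓕 a ξ = 𝓕 b ξ := fun {E} _ _ {a b} hab => by
    rw [Real.fourier_eq', Real.fourier_eq']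
    exact integral_congr_ae (hab.mono fun k hk => by simp only [hk])
  rw [fourier_congr (coeFn_convL1 _ _ _), Real.fourier_bilin_convolution_eq _
    (L1.integrable_coeFn _) (L1.integrable_coeFn _), fourier_congr (coeFn_convL1 _ _ _),
    Real.fourier_bilin_convolution_eq _ (L1.integrable_coeFn _) (L1.integrable_coeFn _),
    ContinuousLinearMap.id_apply]
  simp only [← TCL_apply, ← Complex.coe_smul (Wiener.evalConst d), map_smul,
    smul_apply, smul_smul]
  congr 1
  ring

theorem norm_triW_le {CT : ℝ} (h0 : 0 ≤ CT)
    (hT : ∀ a b c : Cn n, ‖Q.TC a b c‖ ≤ CT * ‖a‖ * ‖b‖ * ‖c‖) (f g h : Wiener d n) :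
    ‖Q.triW f g h‖ ≤ Wiener.evalConst d ^ 2 * CT * ‖f‖ * ‖g‖ * ‖h‖ := by
  rw [triW, norm_smul, norm_pow, Complex.norm_real, Real.norm_of_nonneg (Wiener.evalConst_pos d).le]
  have h1 := norm_convL1_le_of_bound Q.TCL h0 (fun a b =>
    ContinuousLinearMap.opNorm_le_bound _ (by positivity) fun c => hT a b c) f g
  have h2 := norm_convL1_le_of_bound (ContinuousLinearMap.id ℂ (Cn n →L[ℂ] Cn n)) zero_le_one
    (fun a b => by rw [one_mul]; exact a.le_opNorm b) (convL1 Q.TCL f g) h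
  calc _ ≤ Wiener.evalConst d ^ 2 * (1 * (CT * ‖f‖ * ‖g‖) * ‖h‖) := by
        gcongr
        refine h2.trans ?_
        gcongr
    _ = _ := by ring

theorem isDer_triW {l : Fin d} {f f' g g' h h' : Wiener d n} (hf : Wiener.IsDer l f f')
    (hg : Wiener.IsDer l g g') (hh : Wiener.IsDer l h h') :
    Wiener.IsDer l (Q.triW f g h) (Q.triW f' g h + Q.triW f g' h + Q.triW f g h') := by
  have hφ : ∀ x y : Rd d, Complex.I * ((x + y) l : ℂ)
      = Complex.I * (x l : ℂ) + Complex.I * (y l : ℂ) := by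
    intro x y; rw [PiLp.add_apply]; push_cast; ring
  have h2 := convL1_leibniz (ContinuousLinearMap.id ℂ (Cn n →L[ℂ] Cn n))
    (fun k : Rd d => Complex.I * (k l : ℂ)) hφ
    (convL1_leibniz Q.TCL (fun k : Rd d => Complex.I * (k l : ℂ)) hφ hf hg) hh
  have h3 : Q.triW f' g h + Q.triW f g' h + Q.triW f g h' = ((Wiener.evalConst d : ℂ) ^ 2) •
      (convL1 (ContinuousLinearMap.id ℂ (Cn n →L[ℂ] Cn n))
        (convL1 Q.TCL f' g + convL1 Q.TCL f g') h
        + convL1 (ContinuousLinearMap.id ℂ (Cn n →L[ℂ] Cn n)) (convL1 Q.TCL f g) h') := by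
    simp only [triW, map_add, add_apply, smul_add]
  rw [h3]
  exact Wiener.IsDer.const_smul _ h2

theorem triW_sub_left (f f' g h : Wiener d n) :
    Q.triW (f - f') g h = Q.triW f g h - Q.triW f' g h := by
  simp only [triW, map_sub, sub_apply, smul_sub]

theorem triW_sub_mid (f g g' h : Wiener d n) :
    Q.triW f (g - g') h = Q.triW f g h - Q.triW f g' h := by
  simp only [triW, map_sub, sub_apply, smul_sub]

theorem triW_sub_right (f g h h' : Wiener d n) :
    Q.triW f g (h - h') = Q.triW f g h - Q.triW f g h' := by
  simp only [triW, map_sub, smul_sub]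

theorem hasDerivAt_triW {f g h : ℝ → Wiener d n} {f' g' h' : Wiener d n} {t : ℝ}
    (hf : HasDerivAt f f' t) (hg : HasDerivAt g g' t) (hh : HasDerivAt h h' t) :
    HasDerivAt (fun s => Q.triW (f s) (g s) (h s))
      (Q.triW f' (g t) (h t) + Q.triW (f t) g' (h t) + Q.triW (f t) (g t) h') t := by
  have h1 := ((convL1 Q.TCL).bilinearRestrictScalars ℝ).hasFDerivAt_of_bilinear
    hf.hasFDerivAt hg.hasFDerivAt
  have h2 := ((convL1 (V := Rd d) (ContinuousLinearMap.id ℂ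
    (Cn n →L[ℂ] Cn n))).bilinearRestrictScalars ℝ).hasFDerivAt_of_bilinear h1 hh.hasFDerivAt
  have h3 := (h2.const_smul ((Wiener.evalConst d : ℂ) ^ 2)).hasDerivAt
  refine h3.congr_deriv ?_
  simp [triW, smul_add]
  abel

end HypSystem

/-! ### Complex conjugation on `W`. -/

section Conjugation

variable {d n : ℕ}

theorem norm_conjVec (v : Cn n) : ‖conjVec v‖ = ‖v‖ := by
  simp [EuclideanSpace.norm_eq, conjVec]

/-- Entrywise complex conjugation as a real linear map. -/
noncomputable def conjL (n : ℕ) : Cn n →L[ℝ] Cn n :=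
  LinearMap.mkContinuous
    { toFun := conjVec
      map_add' := fun v w => by ext m; simp [conjVec]
      map_smul' := fun c v => by ext m; simp [conjVec] } 1
    fun v => by rw [one_mul]; exact (norm_conjVec v).le

theorem conjL_apply (v : Cn n) : conjL n v = conjVec v := rfl

theorem conjVec_smul (c : ℂ) (v : Cn n) : conjVec (c • v) = starRingEnd ℂ c • conjVec v := by
  ext m; simp [conjVec]

namespace Wiener

theorem integrable_conj (f : Wiener d n) : Integrable fun k => conjVec (f (-k)) :=
  (conjL n).integrable_comp (integrable f).comp_neg

/-- `f ↦ conj f` on `W`. -/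
noncomputable def conjW : Wiener d n →L[ℝ] Wiener d n :=
  LinearMap.mkContinuous
    { toFun := fun f => (integrable_conj f).toL1 _
      map_add' := fun f g => by
        rw [← Integrable.toL1_add, Integrable.toL1_eq_toL1_iff]
        have h := (Measure.measurePreserving_neg (volume : Measure (Rd d))).quasiMeasurePreserving.ae
          (Lp.coeFn_add f g)
        filter_upwards [h] with k hk
        simp only [Pi.add_apply] at hk ⊢
        rw [hk]
        exact (conjL n).map_add _ _
      map_smul' := fun c f => by
        rw [RingHom.id_apply, ← Integrable.toL1_smul, Integrable.toL1_eq_toL1_iff]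
        have h := (Measure.measurePreserving_neg (volume : Measure (Rd d))).quasiMeasurePreserving.ae
          (Lp.coeFn_smul c f)
        filter_upwards [h] with k hk
        simp only [Pi.smul_apply] at hk ⊢
        rw [hk]
        exact (conjL n).map_smul _ _ } 1
    fun f => by
      simp only [LinearMap.coe_mk, AddHom.coe_mk]
      rw [one_mul, L1.norm_of_fun_eq_integral_norm, L1.norm_eq_integral_norm]
      simp only [norm_conjVec]
      rw [integral_neg_eq_self (fun k => ‖f k‖)]

theorem coeFn_conjW (f : Wiener d n) : conjW f =ᵐ[volume] fun k => conjVec (f (-k)) :=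
  (integrable_conj f).coeFn_toL1

theorem norm_conjW_le (f : Wiener d n) : ‖conjW f‖ ≤ ‖f‖ := by
  rw [L1.norm_eq_integral_norm, L1.norm_eq_integral_norm,
    integral_congr_ae ((coeFn_conjW f).mono fun k hk => congrArg norm hk)]
  simp only [norm_conjVec]
  rw [integral_neg_eq_self (fun k => ‖f k‖)]

theorem eval_conjW (f : Wiener d n) (x : Rd d) : eval (conjW f) x = conjVec (eval f x) := by
  rw [eval_congr_ae (coeFn_conjW f), eval, ← conjL_apply, map_smul,
    ← (conjL n).integral_comp_comm (integrable_exp_smul (integrable f) x), ← integral_neg_eq_self]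
  unfold evalConst
  congr 2 with k : 1
  rw [conjL_apply, conjVec_smul, neg_neg, ← Complex.exp_conj]
  congr 2
  simp

theorem IsDer.conjW {l : Fin d} {f g : Wiener d n} (h : IsDer l f g) :
    IsDer l (conjW f) (conjW g) := by
  filter_upwards [coeFn_conjW f, coeFn_conjW g,
    (Measure.measurePreserving_neg (volume : Measure (Rd d))).quasiMeasurePreserving.ae h] with k h1 h2 h3
  rw [h1, h2, h3, conjVec_smul]
  simp

theorem IsDer.add {l : Fin d} {f g f' g' : Wiener d n} (h : IsDer l f g) (h' : IsDer l f' g') :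
    IsDer l (f + f') (g + g') := by
  filter_upwards [h, h', Lp.coeFn_add f f', Lp.coeFn_add g g'] with k h1 h2 h3 h4
  rw [h3, h4, Pi.add_apply, Pi.add_apply, h1, h2, smul_add]

theorem IsDer.zero {l : Fin d} : IsDer l (0 : Wiener d n) 0 := by
  filter_upwards [Lp.coeFn_zero (Cn n) 1 (volume : Measure (Rd d))] with k h
  rw [h, Pi.zero_apply, smul_zero]

theorem IsDer.sum {ι : Type*} {l : Fin d} {f g : ι → Wiener d n} (s : Finset ι)
    (h : ∀ i ∈ s, IsDer l (f i) (g i)) : IsDer l (∑ i ∈ s, f i) (∑ i ∈ s, g i) := by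
  classical
  induction s using Finset.induction_on with
  | empty => simpa using IsDer.zero
  | insert a s ha ih =>
    rw [Finset.sum_insert ha, Finset.sum_insert ha]
    exact (h a (by simp)).add (ih fun i hi => h i (by simp [hi]))

end Wiener

end Conjugation

/-! ### Bounded Fourier multipliers. -/

section Multiplier

variable {d n : ℕ}

namespace Wiener

theorem integrable_mul {m : Rd d → Cn n →L[ℂ] Cn n} (hm : AEStronglyMeasurable m) {C : ℝ}
    (hC : ∀ k, ‖m k‖ ≤ C) (f : Wiener d n) : Integrable fun k => m k (f k) := by
  refine ((integrable f).norm.const_mul C).mono' ?_ (.of_forall fun k => ?_)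
  · exact (ContinuousLinearMap.id ℂ (Cn n →L[ℂ] Cn n)).aestronglyMeasurable_comp₂ hm
      (integrable f).aestronglyMeasurable
  · exact (m k).le_of_opNorm_le (hC k) _

/-- The Fourier multiplier with bounded measurable symbol `m`. -/
noncomputable def mulOp (m : Rd d → Cn n →L[ℂ] Cn n) (hm : AEStronglyMeasurable m) (C : ℝ)
    (hC : ∀ k, ‖m k‖ ≤ C) : Wiener d n →L[ℝ] Wiener d n :=
  LinearMap.mkContinuous
    { toFun := fun f => (integrable_mul hm hC f).toL1 _
      map_add' := fun f g => by
        rw [← Integrable.toL1_add, Integrable.toL1_eq_toL1_iff]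
        filter_upwards [Lp.coeFn_add f g] with k hk
        simp only [Pi.add_apply] at hk ⊢
        rw [hk, map_add]
      map_smul' := fun c f => by
        rw [RingHom.id_apply, ← Integrable.toL1_smul, Integrable.toL1_eq_toL1_iff]
        filter_upwards [Lp.coeFn_smul c f] with k hk
        simp only [Pi.smul_apply] at hk ⊢
        rw [hk, ContinuousLinearMap.map_smul_of_tower] } C
    fun f => by
      simp only [LinearMap.coe_mk, AddHom.coe_mk]
      rw [L1.norm_of_fun_eq_integral_norm, L1.norm_eq_integral_norm, ← integral_const_mul]
      exact integral_mono (integrable_mul hm hC f).norm ((integrable f).norm.const_mul C)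
        fun k => (m k).le_of_opNorm_le (hC k) _

variable {m : Rd d → Cn n →L[ℂ] Cn n} {hm : AEStronglyMeasurable m} {C : ℝ} {hC : ∀ k, ‖m k‖ ≤ C}

theorem coeFn_mulOp (f : Wiener d n) : mulOp m hm C hC f =ᵐ[volume] fun k => m k (f k) :=
  (integrable_mul hm hC f).coeFn_toL1

theorem norm_mulOp_le (f : Wiener d n) : ‖mulOp m hm C hC f‖ ≤ C * ‖f‖ := by
  rw [L1.norm_eq_integral_norm, L1.norm_eq_integral_norm, ← integral_const_mul,
    integral_congr_ae ((coeFn_mulOp (hm := hm) (hC := hC) f).mono fun k hk => congrArg norm hk)]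
  exact integral_mono (integrable_mul hm hC f).norm ((integrable f).norm.const_mul C)
        fun k => (m k).le_of_opNorm_le (hC k) _

theorem IsDer.mulOp {l : Fin d} {f g : Wiener d n} (h : IsDer l f g) :
    IsDer l (mulOp m hm C hC f) (mulOp m hm C hC g) := by
  filter_upwards [h, coeFn_mulOp (hm := hm) (hC := hC) f, coeFn_mulOp (hm := hm) (hC := hC) g]
    with k h1 h2 h3
  rw [h2, h3, h1, map_smul]

/-- Norm comparison from a pointwise bound. -/
theorem norm_le_of_ae {f : Wiener d n} {g : Rd d → ℝ} (hg : Integrable g)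
    (h : ∀ᵐ k, ‖f k‖ ≤ g k) : ‖f‖ ≤ ∫ k, g k := by
  rw [L1.norm_eq_integral_norm]
  exact integral_mono_ae (integrable f).norm hg h

end Wiener

end Multiplier

/-! ### Continuity argument. -/

section Bootstrap

/-- Continuity argument: a strict bound that improves the non-strict one persists. -/
theorem lt_of_bootstrap {X : ℝ → ℝ} {τ B : ℝ} (hX : ContinuousOn X (Icc 0 τ))
    (h : ∀ t ∈ Icc 0 τ, (∀ s ∈ Ico 0 t, X s ≤ B) → X t < B) : ∀ t ∈ Icc 0 τ, X t < B := by
  by_contra! hcon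
  let S := Icc 0 τ ∩ X ⁻¹' Ici B
  have hS : IsClosed S := hX.preimage_isClosed_of_isClosed isClosed_Icc isClosed_Ici
  have hne : S.Nonempty := by
    obtain ⟨t, ht, hBt⟩ := hcon
    exact ⟨t, ht, hBt⟩
  have hbdd : BddBelow S := ⟨0, fun t ht => ht.1.1⟩
  have hmem := hS.csInf_mem hne hbdd
  -- The infimum is the first time at which `B` is reached, so the premise of `h` holds there. At
  -- time `0` this premise is vacuous, so `h` also contains the initial bound.
  refine absurd (h _ hmem.1 fun s hs => ?_) (not_lt.2 hmem.2)
  by_contra! hlt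
  exact absurd (csInf_le hbdd ⟨⟨hs.1, hs.2.le.trans hmem.1.2⟩, hlt.le⟩) (not_le.2 hs.2)

end Bootstrap

/-! ### `L¹` estimates for scalar transport equations. -/

section Transport

variable {d n : ℕ}

/-- The linear bound serves as the integrable majorant, since `φa` is in `L¹` but `φ²a` need not be.
The quadratic bound in the next lemma is used only for the pointwise limit. -/
theorem norm_exp_neg_sub_one_add_le (y : ℝ) :
    ‖Complex.exp (-(Complex.I * (y : ℂ))) - 1 + Complex.I * (y : ℂ)‖ ≤ 2 * |y| := by
  have h := Real.norm_exp_I_mul_ofReal_sub_one_le (x := -y)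
  have h1 : Complex.exp (-(Complex.I * (y : ℂ))) = Complex.exp (Complex.I * ((-y : ℝ) : ℂ)) := by
    congr 1; push_cast; ring
  rw [h1]
  refine (norm_add_le _ _).trans ?_
  have h2 : ‖Complex.I * (y : ℂ)‖ = |y| := by simp
  rw [h2]
  rw [norm_neg, Real.norm_eq_abs] at h
  linarith

theorem norm_exp_neg_sub_one_add_le_sq {y : ℝ} (hy : |y| ≤ 1) :
    ‖Complex.exp (-(Complex.I * (y : ℂ))) - 1 + Complex.I * (y : ℂ)‖ ≤ y ^ 2 := by
  have h := Complex.norm_exp_sub_one_sub_id_le (x := -(Complex.I * (y : ℂ))) (by simpa using hy)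
  simpa [sub_neg_eq_add] using h

theorem norm_exp_neg_I_mul (y : ℝ) : ‖Complex.exp (-(Complex.I * (y : ℂ)))‖ = 1 := by
  rw [show -(Complex.I * (y : ℂ)) = ((-y : ℝ) : ℂ) * Complex.I by push_cast; ring,
    Complex.norm_exp_ofReal_mul_I]

open Filter Topology in
/-- The multiplication group `e^{-ihφ}` is differentiable at `h = 0` on its domain. -/
theorem tendsto_integral_norm_exp_sub {φ : Rd d → ℝ} (hφ : Measurable φ) {a : Rd d → Cn n}
    (ha : AEStronglyMeasurable a) (hφa : Integrable fun k => φ k • a k) :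
    Tendsto (fun h : ℝ => ∫ k, h⁻¹ * ‖(Complex.exp (-(Complex.I * ((h * φ k : ℝ) : ℂ))) - 1
      + Complex.I * ((h * φ k : ℝ) : ℂ)) • a k‖) (𝓝[>] 0) (𝓝 0) := by
  have h0 : (0 : ℝ) = ∫ _ : Rd d, (0 : ℝ) := by simp
  rw [h0]
  refine tendsto_integral_filter_of_dominated_convergence (fun k => 2 * ‖φ k • a k‖) ?_ ?_
    (hφa.norm.const_mul 2) (.of_forall fun k => ?_)
  · refine .of_forall fun h => ?_
    refine AEStronglyMeasurable.const_mul (AEStronglyMeasurable.norm ?_) _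
    exact AEStronglyMeasurable.smul (by fun_prop : Measurable fun k =>
      Complex.exp (-(Complex.I * ((h * φ k : ℝ) : ℂ))) - 1
        + Complex.I * ((h * φ k : ℝ) : ℂ)).aestronglyMeasurable ha
  · rw [← h0]
    filter_upwards [self_mem_nhdsWithin] with h hh
    refine .of_forall fun k => ?_
    have hpos : (0 : ℝ) < h := hh
    rw [Real.norm_of_nonneg (by positivity), norm_smul, norm_smul, inv_mul_le_iff₀ hpos]
    have := norm_exp_neg_sub_one_add_le (h * φ k)
    rw [abs_mul, abs_of_pos hpos] at this
    calc _ ≤ (2 * (h * |φ k|)) * ‖a k‖ := by gcongr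
      _ = _ := by rw [Real.norm_eq_abs]; ring
  · rw [← h0]
    have hlim : Tendsto (fun h : ℝ => h * ((φ k) ^ 2 * ‖a k‖)) (𝓝[>] 0) (𝓝 0) := by
      have : Tendsto (fun h : ℝ => h * ((φ k) ^ 2 * ‖a k‖)) (𝓝 0) (𝓝 (0 * ((φ k) ^ 2 * ‖a k‖))) :=
        (continuous_id.mul continuous_const).tendsto 0
      rw [zero_mul] at this
      exact this.mono_left nhdsWithin_le_nhds
    have hsmall : ∀ᶠ h : ℝ in 𝓝[>] 0, |h * φ k| ≤ 1 := by
      have : Tendsto (fun h : ℝ => |h * φ k|) (𝓝 0) (𝓝 |0 * φ k|) :=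
        ((continuous_id.mul continuous_const).abs).tendsto 0
      rw [zero_mul, abs_zero] at this
      exact ((this.eventually_lt_const one_pos).mono fun h hh => hh.le).filter_mono
        nhdsWithin_le_nhds
    refine squeeze_zero' ?_ ?_ hlim
    · filter_upwards [self_mem_nhdsWithin] with h hh
      have hpos : (0 : ℝ) < h := hh
      positivity
    · filter_upwards [self_mem_nhdsWithin, hsmall] with h hh hs
      have hpos : (0 : ℝ) < h := hh
      rw [norm_smul, inv_mul_le_iff₀ hpos]
      calc _ ≤ (h * φ k) ^ 2 * ‖a k‖ := by
            gcongr; exact norm_exp_neg_sub_one_add_le_sq hs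
        _ = _ := by ring

/-- An explicit Euler step is compared with the exact rotation `e^{-ihφ}a + hf`, whose norm is at
most `‖a‖ + h‖f‖`. The defect is written as `h` times the integral in
`tendsto_integral_norm_exp_sub`, hence it is `o(h)`. -/
theorem norm_add_smul_le_of_transport {φ : Rd d → ℝ} (hφ : Measurable φ) {a a' f : Wiener d n}
    (heq : ∀ᵐ k, a' k = -(Complex.I * (φ k : ℂ)) • a k + f k) {h : ℝ} (hh : 0 < h) :
    ‖a + h • a'‖ ≤ ‖a‖ + h * ‖f‖ + h * ∫ k, h⁻¹ * ‖(Complex.exp (-(Complex.I * ((h * φ k : ℝ) : ℂ))) - 1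
      + Complex.I * ((h * φ k : ℝ) : ℂ)) • a k‖ := by
  -- Although `φ` is unbounded, the equation itself expresses `φa` through `a'` and `f`, which are
  -- in `L¹`.
  have hφa : Integrable fun k => φ k • a k := by
    refine ((Wiener.integrable a').norm.add (Wiener.integrable f).norm).mono'
      (hφ.aestronglyMeasurable.smul (Wiener.integrable a).aestronglyMeasurable) ?_
    filter_upwards [heq] with k hk
    have : ‖φ k • a k‖ = ‖a' k - f k‖ := by rw [hk]; simp [norm_smul]
    rw [this]
    exact norm_sub_le _ _
  have hInt : Integrable fun k => ‖(Complex.exp (-(Complex.I * ((h * φ k : ℝ) : ℂ))) - 1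
      + Complex.I * ((h * φ k : ℝ) : ℂ)) • a k‖ := by
    refine Integrable.mono' (hφa.norm.const_mul (2 * h)) ?_ (.of_forall fun k => ?_)
    · refine AEStronglyMeasurable.norm ?_
      exact AEStronglyMeasurable.smul (by fun_prop : Measurable fun k =>
        Complex.exp (-(Complex.I * ((h * φ k : ℝ) : ℂ))) - 1
          + Complex.I * ((h * φ k : ℝ) : ℂ)).aestronglyMeasurable
        (Wiener.integrable a).aestronglyMeasurable
    · rw [norm_norm, norm_smul, norm_smul]
      have := norm_exp_neg_sub_one_add_le (h * φ k)
      rw [abs_mul, abs_of_pos hh] at this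
      calc _ ≤ (2 * (h * |φ k|)) * ‖a k‖ := by gcongr
        _ = _ := by rw [Real.norm_eq_abs]; ring
  have hsum : Integrable fun k => ‖a k‖ + h * ‖f k‖ :=
    (Wiener.integrable a).norm.add ((Wiener.integrable f).norm.const_mul h)
  rw [integral_const_mul, mul_inv_cancel_left₀ hh.ne', L1.norm_eq_integral_norm a,
    L1.norm_eq_integral_norm f, ← integral_const_mul,
    ← integral_add (Wiener.integrable a).norm ((Wiener.integrable f).norm.const_mul h),
    ← integral_add hsum hInt]
  refine Wiener.norm_le_of_ae (hsum.add hInt) ?_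
  filter_upwards [heq, Lp.coeFn_add a (h • a'), Lp.coeFn_smul h a'] with k h1 h2 h3
  rw [h2, Pi.add_apply, h3, Pi.smul_apply, h1]
  have e : a k + h • (-(Complex.I * (φ k : ℂ)) • a k + f k)
      = Complex.exp (-(Complex.I * ((h * φ k : ℝ) : ℂ))) • a k + h • f k
        - (Complex.exp (-(Complex.I * ((h * φ k : ℝ) : ℂ))) - 1
          + Complex.I * ((h * φ k : ℝ) : ℂ)) • a k := by
    rw [← Complex.coe_smul h, ← Complex.coe_smul h]
    push_cast
    module
  rw [e]
  refine (norm_sub_le _ _).trans ?_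
  gcongr
  refine (norm_add_le _ _).trans ?_
  rw [norm_smul, norm_smul, norm_exp_neg_I_mul, one_mul, Real.norm_of_nonneg hh.le]

open Filter Topology in
/-- `L¹` estimate for `∂ₜa + iφ(k) a = f` with a real symbol `φ`. -/
theorem norm_le_of_transport {φ : Rd d → ℝ} (hφ : Measurable φ) {τ c : ℝ}
    {a a' f : ℝ → Wiener d n} (hcont : ContinuousOn a (Icc 0 τ))
    (hder : ∀ t ∈ Ioo 0 τ, HasDerivAt a (a' t) t)
    (heq : ∀ t ∈ Ioo 0 τ, ∀ᵐ k, a' t k = -(Complex.I * (φ k : ℂ)) • a t k + f t k)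
    (hf : ∀ t ∈ Ioo 0 τ, ‖f t‖ ≤ c) : ∀ t ∈ Icc 0 τ, ‖a t‖ ≤ ‖a 0‖ + c * t := by
  -- The norm need not be differentiable, but its right difference quotients are at most `c` up to
  -- the Euler defect and the error of the difference quotient of `a`, both of which vanish in the
  -- limit.
  have slope_lt : ∀ t ∈ Ioo 0 τ, ∀ r, c < r →
      ∃ᶠ z in 𝓝[>] t, slope (fun s => ‖a s‖) t z < r := by
    intro t ht r hr
    refine Eventually.frequently ?_
    have hφa : Integrable fun k => φ k • a t k := by
      refine ((Wiener.integrable (a' t)).norm.add (Wiener.integrable (f t)).norm).mono'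
        (hφ.aestronglyMeasurable.smul (Wiener.integrable (a t)).aestronglyMeasurable) ?_
      filter_upwards [heq t ht] with k hk
      have : ‖φ k • a t k‖ = ‖a' t k - f t k‖ := by rw [hk]; simp [norm_smul]
      rw [this]
      exact norm_sub_le _ _
    have hsub : Tendsto (fun z : ℝ => z - t) (𝓝[>] t) (𝓝[>] 0) := by
      refine tendsto_nhdsWithin_iff.2 ⟨?_, ?_⟩
      · have : Tendsto (fun z : ℝ => z - t) (𝓝 t) (𝓝 (t - t)) :=
          (continuous_id.sub continuous_const).tendsto t
        rw [sub_self] at this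
        exact this.mono_left nhdsWithin_le_nhds
      · filter_upwards [self_mem_nhdsWithin] with z hz
        exact sub_pos.2 (show t < z from hz)
    have l1 := (tendsto_integral_norm_exp_sub hφ
      (Wiener.integrable (a t)).aestronglyMeasurable hφa).comp hsub
    have l2 : Tendsto (fun z => ‖slope a t z - a' t‖) (𝓝[>] t) (𝓝 0) := by
      have := (hasDerivAt_iff_tendsto_slope.1 (hder t ht)).sub_const (a' t)
      rw [sub_self] at this
      have := this.norm
      rw [norm_zero] at this
      exact this.mono_left (nhdsWithin_mono _ fun z hz => ne_of_gt hz)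
    have l3 := (l1.add l2).eventually_lt_const
      (show (0 : ℝ) + 0 < r - c by rw [add_zero]; exact sub_pos.2 hr)
    filter_upwards [l3, self_mem_nhdsWithin] with z hz hzt
    have hpos : 0 < z - t := sub_pos.2 hzt
    have key := norm_add_smul_le_of_transport hφ (heq t ht) hpos
    have hdecomp : a z = (a t + (z - t) • a' t) + (z - t) • (slope a t z - a' t) := by
      rw [smul_sub, sub_smul_slope]; simp only [vsub_eq_sub]; abel
    have hz2 : ‖a z‖ ≤ ‖a t + (z - t) • a' t‖ + (z - t) * ‖slope a t z - a' t‖ := by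
      conv_lhs => rw [hdecomp]
      refine (norm_add_le _ _).trans_eq ?_
      rw [norm_smul, Real.norm_of_nonneg hpos.le]
    rw [slope_def_field, div_lt_iff₀ hpos]
    simp only [Function.comp_apply] at hz
    have hmul := mul_lt_mul_of_pos_left hz hpos
    have hfc := mul_le_mul_of_nonneg_left (hf t ht) hpos.le
    linarith
  have hnorm : ContinuousOn (fun s => ‖a s‖) (Icc 0 τ) := hcont.norm
  -- The derivative is available only at interior times, so the comparison starts at `δ > 0`, and `δ
  -- → 0` by continuity.
  have main : ∀ δ t, 0 < δ → δ ≤ t → t ≤ τ → ‖a t‖ ≤ ‖a δ‖ + c * (t - δ) := by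
    intro δ t hδ hδt htτ
    have hB : ∀ x : ℝ, HasDerivAt (fun x : ℝ => ‖a δ‖ + c * (x - δ)) c x := fun x => by
      simpa using (((hasDerivAt_id x).sub_const δ).const_mul c).const_add ‖a δ‖
    refine image_le_of_liminf_slope_right_le_deriv_boundary (f := fun s => ‖a s‖) (a := δ) (b := t)
      (B := fun x => ‖a δ‖ + c * (x - δ)) (B' := fun _ => c)
      (hnorm.mono (Icc_subset_Icc hδ.le htτ)) (by simp)
      (fun x _ => (hB x).continuousAt.continuousWithinAt)
      (fun x _ => (hB x).hasDerivWithinAt)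
      (fun x hx => slope_lt x ⟨hδ.trans_le hx.1, hx.2.trans_le htτ⟩) ⟨hδt, le_rfl⟩
  intro t ht
  rcases ht.1.eq_or_lt with rfl | h0
  · simp
  have lim1 : Tendsto (fun δ => ‖a δ‖) (𝓝[>] 0) (𝓝 ‖a 0‖) := by
    have h1 := hnorm 0 ⟨le_rfl, ht.1.trans ht.2⟩
    refine h1.tendsto.mono_left (nhdsWithin_le_iff.2 ?_)
    exact mem_of_superset (Ioo_mem_nhdsGT (h0.trans_le ht.2)) Ioo_subset_Icc_self
  have lim2 : Tendsto (fun δ : ℝ => c * (t - δ)) (𝓝[>] 0) (𝓝 (c * (t - 0))) :=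
    ((continuous_const.mul (continuous_const.sub continuous_id)).tendsto 0).mono_left
      nhdsWithin_le_nhds
  rw [sub_zero] at lim2
  refine ge_of_tendsto (lim1.add lim2) ?_
  filter_upwards [Ioo_mem_nhdsGT h0] with δ hδ
  exact main δ t hδ.1 hδ.2.le ht.2

/-- The symbol `i k_l` cut off to the ball of radius `R`. -/
noncomputable def derCutoff (n : ℕ) (l : Fin d) (R : ℝ) (k : Rd d) : Cn n →L[ℂ] Cn n :=
  (Metric.closedBall (0 : Rd d) R).indicator (fun k => Complex.I * (k l : ℂ)) k •
    ContinuousLinearMap.id ℂ (Cn n)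

theorem aestronglyMeasurable_derCutoff (n : ℕ) (l : Fin d) (R : ℝ) :
    AEStronglyMeasurable (derCutoff n l R) := by
  refine AEStronglyMeasurable.smul_const ?_ _
  exact ((by fun_prop : Continuous fun k : Rd d =>
    Complex.I * (k l : ℂ)).aestronglyMeasurable).indicator Metric.isClosed_closedBall.measurableSet

theorem norm_derCutoff_le (n : ℕ) (l : Fin d) {R : ℝ} (hR : 0 ≤ R) (k : Rd d) :
    ‖derCutoff n l R k‖ ≤ R := by
  unfold derCutoff
  rw [norm_smul]
  have h1 : ‖ContinuousLinearMap.id ℂ (Cn n)‖ ≤ 1 := ContinuousLinearMap.norm_id_le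
  have h2 : ‖(Metric.closedBall (0 : Rd d) R).indicator (fun k => Complex.I * (k l : ℂ)) k‖ ≤ R := by
    by_cases hk : k ∈ Metric.closedBall (0 : Rd d) R
    · rw [indicator_of_mem hk]
      have := PiLp.norm_apply_le k l
      simp only [norm_mul, Complex.norm_I, one_mul, Complex.norm_real]
      exact this.trans (mem_closedBall_zero_iff.1 hk)
    · rw [indicator_of_notMem hk, norm_zero]; exact hR
  calc _ ≤ R * 1 := by gcongr
    _ = R := mul_one R

theorem Wiener.IsDer.ae_derCutoff {l : Fin d} {f g : Wiener d n} (h : IsDer l f g) (R : ℝ) :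
    ∀ᵐ k, derCutoff n l R k (f k) = (Metric.closedBall (0 : Rd d) R).indicator g k := by
  filter_upwards [h] with k hk
  unfold derCutoff
  by_cases hR : k ∈ Metric.closedBall (0 : Rd d) R
  · rw [indicator_of_mem hR, indicator_of_mem hR, hk]; rfl
  · rw [indicator_of_notMem hR, indicator_of_notMem hR]; exact zero_smul ℂ (f k)

/-- Inside the ball the cut-off symbol is exactly that of `∂_l`, and being bounded it acts on all of
`W`. -/
theorem Wiener.norm_eq_setIntegral_of_isDer {l : Fin d} {f g : Wiener d n} (h : IsDer l f g)
    {R : ℝ} (hR : 0 ≤ R) :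
    ‖mulOp _ (aestronglyMeasurable_derCutoff n l R) R (norm_derCutoff_le n l hR) f‖
      = ∫ k in Metric.closedBall (0 : Rd d) R, ‖g k‖ := by
  rw [L1.norm_eq_integral_norm, ← integral_indicator Metric.isClosed_closedBall.measurableSet]
  refine integral_congr_ae ?_
  filter_upwards [coeFn_mulOp (hm := aestronglyMeasurable_derCutoff n l R)
    (hC := norm_derCutoff_le n l hR) f, h.ae_derCutoff R] with k h1 h2
  rw [h1, h2]
  exact norm_indicator_eq_indicator_norm _ _

open Filter Topology in
/-- The estimate of `norm_le_of_transport` for the partial derivatives. -/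
theorem norm_der_le_of_transport {φ : Rd d → ℝ} (hφ : Measurable φ) {τ c : ℝ} {l : Fin d}
    {a a' f al fl : ℝ → Wiener d n} (hcont : ContinuousOn a (Icc 0 τ))
    (hder : ∀ t ∈ Ioo 0 τ, HasDerivAt a (a' t) t)
    (heq : ∀ t ∈ Ioo 0 τ, ∀ᵐ k, a' t k = -(Complex.I * (φ k : ℂ)) • a t k + f t k)
    (hal : ∀ t ∈ Icc 0 τ, Wiener.IsDer l (a t) (al t))
    (hfl : ∀ t ∈ Ioo 0 τ, Wiener.IsDer l (f t) (fl t))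
    (hf : ∀ t ∈ Ioo 0 τ, ‖fl t‖ ≤ c) : ∀ t ∈ Icc 0 τ, ‖al t‖ ≤ ‖al 0‖ + c * t := by
  intro t ht
  have set_le : ∀ (g : Wiener d n) (R : ℝ),
      ∫ k in Metric.closedBall (0 : Rd d) R, ‖g k‖ ≤ ‖g‖ := fun g R => by
    rw [L1.norm_eq_integral_norm]
    exact setIntegral_le_integral (Wiener.integrable g).norm (.of_forall fun k => norm_nonneg _)
  have bound : ∀ m : ℕ, ∫ k in Metric.closedBall (0 : Rd d) (m : ℝ), ‖al t k‖ ≤ ‖al 0‖ + c * t := by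
    intro m
    have hm : (0 : ℝ) ≤ m := m.cast_nonneg
    -- The curve `al` is not assumed differentiable in time, so the transport estimate is applied to
    -- the cut-off derivative of `a`. The cut-off commutes with `φ`, and the resulting bound is
    -- uniform in the radius.
    let M := Wiener.mulOp _ (aestronglyMeasurable_derCutoff n l (m : ℝ)) m (norm_derCutoff_le n l hm)
    have h1 := norm_le_of_transport hφ (a := fun s => M (a s)) (a' := fun s => M (a' s))
      (f := fun s => M (f s)) (c := c) (τ := τ) (M.continuous.comp_continuousOn hcont)
      (fun s hs => M.hasFDerivAt.comp_hasDerivAt s (hder s hs))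
      (fun s hs => by
        filter_upwards [heq s hs, Wiener.coeFn_mulOp (hm := aestronglyMeasurable_derCutoff n l m)
          (hC := norm_derCutoff_le n l hm) (a s), Wiener.coeFn_mulOp
          (hm := aestronglyMeasurable_derCutoff n l m) (hC := norm_derCutoff_le n l hm) (a' s),
          Wiener.coeFn_mulOp (hm := aestronglyMeasurable_derCutoff n l m)
          (hC := norm_derCutoff_le n l hm) (f s)] with k e1 e2 e3 e4
        simp only [M]
        rw [e2, e3, e4, e1, map_add, map_smul])
      (fun s hs => by
        simp only [M]
        rw [Wiener.norm_eq_setIntegral_of_isDer (hfl s hs) hm]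
        exact (set_le _ _).trans (hf s hs)) t ht
    simp only [M] at h1
    rw [Wiener.norm_eq_setIntegral_of_isDer (hal t ht) hm,
      Wiener.norm_eq_setIntegral_of_isDer (hal 0 ⟨le_rfl, ht.1.trans ht.2⟩) hm] at h1
    exact h1.trans (by gcongr; exact set_le _ _)
  have cover : AECover (volume : Measure (Rd d)) atTop
      fun m : ℕ => Metric.closedBall (0 : Rd d) (m : ℝ) :=
    aecover_closedBall tendsto_natCast_atTop_atTop
  rw [L1.norm_eq_integral_norm (al t)]
  exact le_of_tendsto (cover.integral_tendsto_of_countably_generated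
    (Wiener.integrable (al t)).norm) (.of_forall bound)

end Transport

/-! ### The cubic nonlinearity and its linearization. -/

section Nonlinearity

variable {d n : ℕ}

/-- `u_j` as an element of `W`, for `j ∈ {±1, ±3}`. -/
noncomputable def modeW (u₁ u₃ : Wiener d n) (j : ℤ) : Wiener d n :=
  if j = 1 then u₁
  else if j = 3 then u₃
  else if j = -1 then Wiener.conjW u₁
  else if j = -3 then Wiener.conjW u₃
  else 0

theorem eval_modeW (u₁ u₃ : Wiener d n) (j : ℤ) (x : Rd d) :
    Wiener.eval (modeW u₁ u₃ j) x = modeVal u₁ u₃ j x := by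
  unfold modeW modeVal
  split_ifs
  · rfl
  · rfl
  · exact Wiener.eval_conjW _ _
  · exact Wiener.eval_conjW _ _
  · exact map_zero (Wiener.evalₗ x)

theorem norm_modeW_le (u₁ u₃ : Wiener d n) (j : ℤ) : ‖modeW u₁ u₃ j‖ ≤ ‖u₁‖ + ‖u₃‖ := by
  have h1 := Wiener.norm_conjW_le u₁
  have h3 := Wiener.norm_conjW_le u₃
  have n1 := norm_nonneg u₁
  have n3 := norm_nonneg u₃
  unfold modeW
  split_ifs
  · linarith
  · linarith
  · linarith
  · linarith
  · rw [norm_zero]; linarith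

theorem modeW_sub (u₁ u₃ v₁ v₃ : Wiener d n) (j : ℤ) :
    modeW u₁ u₃ j - modeW v₁ v₃ j = modeW (u₁ - v₁) (u₃ - v₃) j := by
  unfold modeW
  split_ifs <;> simp

theorem Wiener.IsDer.modeW {l : Fin d} {u₁ u₃ v₁ v₃ : Wiener d n} (h₁ : IsDer l u₁ v₁)
    (h₃ : IsDer l u₃ v₃) (j : ℤ) : IsDer l (modeW u₁ u₃ j) (modeW v₁ v₃ j) := by
  unfold _root_.modeW
  split_ifs
  · exact h₁
  · exact h₃
  · exact h₁.conjW
  · exact h₃.conjW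
  · exact IsDer.zero

theorem hasDerivAt_modeW {u₁ u₃ : ℝ → Wiener d n} {v₁ v₃ : Wiener d n} {t : ℝ}
    (h₁ : HasDerivAt u₁ v₁ t) (h₃ : HasDerivAt u₃ v₃ t) (j : ℤ) :
    HasDerivAt (fun s => modeW (u₁ s) (u₃ s) j) (modeW v₁ v₃ j) t := by
  unfold modeW
  split_ifs
  · exact h₁
  · exact h₃
  · exact Wiener.conjW.hasFDerivAt.comp_hasDerivAt t h₁
  · exact Wiener.conjW.hasFDerivAt.comp_hasDerivAt t h₃
  · exact hasDerivAt_const _ _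

/-- A crude count of all `4³` triples, which suffices for the constants. With the three slots of the
Leibniz rule or of a telescoping difference it becomes `192` later on. -/
theorem card_triads_le (j : ℤ) : ((triads j).card : ℝ) ≤ 64 := by
  have h1 : (triads j).card ≤ (harmonics ×ˢ harmonics ×ˢ harmonics).card :=
    Finset.card_filter_le _ _
  have h2 : (harmonics ×ˢ harmonics ×ˢ harmonics).card = 64 := by decide
  exact_mod_cast h1.trans h2.le

theorem norm_sum_triads_le {F : ℤ × ℤ × ℤ → Wiener d n} {B : ℝ} (hB : 0 ≤ B)
    (h : ∀ J, ‖F J‖ ≤ B) (j : ℤ) : ‖∑ J ∈ triads j, F J‖ ≤ 64 * B := by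
  refine (norm_sum_le_of_le _ fun J _ => h J).trans ?_
  rw [Finset.sum_const, nsmul_eq_mul]
  gcongr
  exact card_triads_le j

namespace HypSystem

variable (Q : HypSystem d n)

/-- The nonlinearity `∑ T(u_{j₁}, u_{j₂}, u_{j₃})` on `W`. -/
noncomputable def nonlin (m : ℤ → Wiener d n) (j : ℤ) : Wiener d n :=
  ∑ J ∈ triads j, Q.triW (m J.1) (m J.2.1) (m J.2.2)

/-- The linearization of `nonlin` at `m` in the direction `m'`. -/
noncomputable def nonlinD (m m' : ℤ → Wiener d n) (j : ℤ) : Wiener d n :=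
  ∑ J ∈ triads j, (Q.triW (m' J.1) (m J.2.1) (m J.2.2) + Q.triW (m J.1) (m' J.2.1) (m J.2.2)
    + Q.triW (m J.1) (m J.2.1) (m' J.2.2))

theorem eval_nonlin (m : ℤ → Wiener d n) (j : ℤ) (x : Rd d) :
    Wiener.eval (Q.nonlin m j) x = ∑ J ∈ triads j, Q.TC (Wiener.eval (m J.1) x)
      (Wiener.eval (m J.2.1) x) (Wiener.eval (m J.2.2) x) := by
  rw [nonlin, ← Wiener.evalₗ_apply, map_sum]
  simp only [Wiener.evalₗ_apply, eval_triW]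

theorem isDer_nonlin {l : Fin d} {m m' : ℤ → Wiener d n}
    (h : ∀ i, Wiener.IsDer l (m i) (m' i)) (j : ℤ) :
    Wiener.IsDer l (Q.nonlin m j) (Q.nonlinD m m' j) :=
  Wiener.IsDer.sum _ fun _ _ => Q.isDer_triW (h _) (h _) (h _)

theorem hasDerivAt_nonlin {m : ℝ → ℤ → Wiener d n} {m' : ℤ → Wiener d n} {t : ℝ}
    (h : ∀ i, HasDerivAt (fun s => m s i) (m' i) t) (j : ℤ) :
    HasDerivAt (fun s => Q.nonlin (m s) j) (Q.nonlinD (m t) m' j) t :=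
  HasDerivAt.fun_sum fun _ _ => Q.hasDerivAt_triW (h _) (h _) (h _)

variable {c : ℝ}

theorem norm_triW_le_of_le (hc : 0 ≤ c)
    (hT : ∀ f g h : Wiener d n, ‖Q.triW f g h‖ ≤ c * ‖f‖ * ‖g‖ * ‖h‖)
    {f g h : Wiener d n} {x y z : ℝ} (hf : ‖f‖ ≤ x) (hg : ‖g‖ ≤ y)
    (hh : ‖h‖ ≤ z) : ‖Q.triW f g h‖ ≤ c * x * y * z := by
  have hx := (norm_nonneg f).trans hf
  have hy := (norm_nonneg g).trans hg
  refine (hT f g h).trans ?_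
  gcongr

theorem norm_nonlin_le (hc : 0 ≤ c)
    (hT : ∀ f g h : Wiener d n, ‖Q.triW f g h‖ ≤ c * ‖f‖ * ‖g‖ * ‖h‖)
    {m : ℤ → Wiener d n} {R : ℝ} (hm : ∀ i, ‖m i‖ ≤ R) (j : ℤ) :
    ‖Q.nonlin m j‖ ≤ 64 * (c * R ^ 3) := by
  have hR : 0 ≤ R := (norm_nonneg _).trans (hm 0)
  refine norm_sum_triads_le (by positivity) (fun J =>
    (Q.norm_triW_le_of_le hc hT (hm _) (hm _) (hm _)).trans_eq (by ring)) j

theorem norm_nonlinD_le (hc : 0 ≤ c)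
    (hT : ∀ f g h : Wiener d n, ‖Q.triW f g h‖ ≤ c * ‖f‖ * ‖g‖ * ‖h‖)
    {m m' : ℤ → Wiener d n} {R R' : ℝ} (hm : ∀ i, ‖m i‖ ≤ R)
    (hm' : ∀ i, ‖m' i‖ ≤ R') (j : ℤ) : ‖Q.nonlinD m m' j‖ ≤ 64 * (3 * c * R ^ 2 * R') := by
  have hR : 0 ≤ R := (norm_nonneg _).trans (hm 0)
  have hR' : 0 ≤ R' := (norm_nonneg _).trans (hm' 0)
  refine norm_sum_triads_le (by positivity) (fun J => ?_) j
  refine norm_add₃_le.trans ?_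
  have h1 := Q.norm_triW_le_of_le hc hT (hm' J.1) (hm J.2.1) (hm J.2.2)
  have h2 := Q.norm_triW_le_of_le hc hT (hm J.1) (hm' J.2.1) (hm J.2.2)
  have h3 := Q.norm_triW_le_of_le hc hT (hm J.1) (hm J.2.1) (hm' J.2.2)
  exact (add_le_add (add_le_add h1 h2) h3).trans_eq (by ring)

theorem norm_nonlin_sub_le (hc : 0 ≤ c)
    (hT : ∀ f g h : Wiener d n, ‖Q.triW f g h‖ ≤ c * ‖f‖ * ‖g‖ * ‖h‖)
    {m m₀ : ℤ → Wiener d n} {R y : ℝ} (hm : ∀ i, ‖m i‖ ≤ R)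
    (hm₀ : ∀ i, ‖m₀ i‖ ≤ R) (hy : ∀ i, ‖m i - m₀ i‖ ≤ y) (j : ℤ) :
    ‖Q.nonlin m j - Q.nonlin m₀ j‖ ≤ 64 * (3 * c * R ^ 2 * y) := by
  have hR : 0 ≤ R := (norm_nonneg _).trans (hm 0)
  have hy0 : 0 ≤ y := (norm_nonneg _).trans (hy 0)
  unfold nonlin
  rw [← Finset.sum_sub_distrib]
  refine norm_sum_triads_le (by positivity) (fun J => ?_) j
  have e : Q.triW (m J.1) (m J.2.1) (m J.2.2) - Q.triW (m₀ J.1) (m₀ J.2.1) (m₀ J.2.2)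
      = Q.triW (m J.1 - m₀ J.1) (m J.2.1) (m J.2.2)
        + Q.triW (m₀ J.1) (m J.2.1 - m₀ J.2.1) (m J.2.2)
        + Q.triW (m₀ J.1) (m₀ J.2.1) (m J.2.2 - m₀ J.2.2) := by
    rw [triW_sub_left, triW_sub_mid, triW_sub_right]; abel
  rw [e]
  refine norm_add₃_le.trans ?_
  have h1 := Q.norm_triW_le_of_le hc hT (hy J.1) (hm J.2.1) (hm J.2.2)
  have h2 := Q.norm_triW_le_of_le hc hT (hm₀ J.1) (hy J.2.1) (hm J.2.2)
  have h3 := Q.norm_triW_le_of_le hc hT (hm₀ J.1) (hm₀ J.2.1) (hy J.2.2)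
  exact (add_le_add (add_le_add h1 h2) h3).trans_eq (by ring)

end HypSystem

end Nonlinearity

/-! ### Spectral properties of `L(α, β)`. -/

section LinearAlgebra

variable {d n : ℕ} (Q : HypSystem d n)

namespace HypSystem

/-- The matrix `A_l` acting on `ℂⁿ`. -/
noncomputable def AOp (l : Fin d) : Cn n →ₗ[ℂ] Cn n :=
  Matrix.toEuclideanLin ((Q.A l).map Complex.ofReal)

theorem L_isHermitian (α : ℝ) (β : Rd d) : (Q.L α β).IsHermitian := by
  ext i j
  have hA : ∀ l, Q.A l j i = Q.A l i j := fun l => (Q.A_symm l).apply i j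
  have hE : Q.E j i = -Q.E i j := by
    have := congrFun (congrFun Q.E_skew i) j
    simpa using this
  simp only [L, Matrix.conjTranspose_apply, Matrix.sub_apply, Matrix.add_apply, Matrix.smul_apply,
    Matrix.sum_apply, Matrix.map_apply, hA, hE, Matrix.one_apply, eq_comm (a := j)]
  simp [apply_ite (starRingEnd ℂ), sub_eq_add_neg]

/-- With `γ = εk` this absorbs the transport term `A(∂)` into the frequency argument of `L`. -/
theorem toEuclideanLin_L_add (α : ℝ) (β γ : Rd d) (x : Cn n) :
    Matrix.toEuclideanLin (Q.L α β) x + ∑ l, (γ l : ℂ) • Q.AOp l x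
      = Matrix.toEuclideanLin (Q.L 0 (β + γ)) x - (α : ℂ) • x := by
  have h : Q.L α β + ∑ l, (γ l : ℂ) • (Q.A l).map Complex.ofReal
      = Q.L 0 (β + γ) - (α : ℂ) • (1 : Matrix (Fin n) (Fin n) ℂ) := by
    simp only [L, PiLp.add_apply, Complex.ofReal_add, add_smul, Finset.sum_add_distrib,
      Complex.ofReal_zero, neg_zero, zero_smul, neg_smul]
    abel
  have h1 : Matrix.toEuclideanLin (1 : Matrix (Fin n) (Fin n) ℂ) x = x := by
    simp
  have h2 := congrArg (fun M => Matrix.toEuclideanLin M x) h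
  simp only [map_add, map_sum, map_sub, map_smul, LinearMap.add_apply, LinearMap.sub_apply,
    LinearMap.sum_apply, LinearMap.smul_apply, h1] at h2
  exact h2

theorem inner_toEuclideanLin_L {α : ℝ} {β : Rd d} {v : Cn n} {μ : ℝ}
    (hv : Matrix.toEuclideanLin (Q.L α β) v = (μ : ℂ) • v) (x : Cn n) :
    inner ℂ v (Matrix.toEuclideanLin (Q.L α β) x) = (μ : ℂ) * inner ℂ v x := by
  have hs := Matrix.isSymmetric_toEuclideanLin_iff.2 (Q.L_isHermitian α β)
  rw [← hs v x, hv, inner_smul_left, Complex.conj_ofReal]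

end HypSystem

namespace SmoothEigendecomposition

variable {Q} {K : ℝ} {lam : Fin n → Rd d → ℝ} {psi : Fin n → Rd d → Cn n}

/-- The eigenvectors at `β` as an orthonormal basis. -/
noncomputable def basis (hS : SmoothEigendecomposition Q K lam psi)
    (β : Rd d) : OrthonormalBasis (Fin n) ℂ (Cn n) :=
  OrthonormalBasis.mk (hS.orthonormal β)
    ((hS.orthonormal β).linearIndependent.span_eq_top_of_card_eq_finrank' (by simp)).ge

theorem basis_apply (hS : SmoothEigendecomposition Q K lam psi)
    (β : Rd d) (ℓ : Fin n) : hS.basis β ℓ = psi ℓ β := by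
  simp [basis]

theorem sum_inner_smul (hS : SmoothEigendecomposition Q K lam psi)
    (β : Rd d) (x : Cn n) : ∑ ℓ, inner ℂ (psi ℓ β) x • psi ℓ β = x := by
  have := (hS.basis β).sum_repr' x
  simpa only [basis_apply] using this

theorem sum_sq_norm_inner (hS : SmoothEigendecomposition Q K lam psi)
    (β : Rd d) (x : Cn n) : ∑ ℓ, ‖inner ℂ (psi ℓ β) x‖ ^ 2 = ‖x‖ ^ 2 := by
  have := (hS.basis β).sum_sq_norm_inner_right x
  simpa only [basis_apply] using this

theorem norm_toEuclideanLin_L_le (hS : SmoothEigendecomposition Q K lam psi)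
    (β : Rd d) {μ : ℝ} (hμ : ∀ ℓ, |lam ℓ β| ≤ μ) (hμ0 : 0 ≤ μ)
    (x : Cn n) : ‖Matrix.toEuclideanLin (Q.L 0 β) x‖ ≤ μ * ‖x‖ := by
  refine le_of_sq_le_sq ?_ (by positivity)
  rw [mul_pow, ← hS.sum_sq_norm_inner β, ← hS.sum_sq_norm_inner β x, Finset.mul_sum]
  refine Finset.sum_le_sum fun ℓ _ => ?_
  rw [Q.inner_toEuclideanLin_L (hS.eigen ℓ β), norm_mul, mul_pow, Complex.norm_real,
    Real.norm_eq_abs]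
  gcongr
  exact hμ ℓ

/-- Scaling argument: `A(sβ) = L(0, sβ) - L(0, 0)`, and since the eigenvalues are Lipschitz, the
right-hand side has norm at most `2Λ + sK|β|₁`. Dividing by `s` and letting `s → ∞` removes `Λ`, so
no bound on `E` enters. -/
theorem norm_sum_AOp_le (hS : SmoothEigendecomposition Q K lam psi)
    (hK : 0 ≤ K) (β : Rd d) (x : Cn n) :
    ‖∑ l, (β l : ℂ) • Q.AOp l x‖ ≤ K * (∑ l, |β l|) * ‖x‖ := by
  set Λ := ∑ ℓ, |lam ℓ 0|
  have hΛ0 : 0 ≤ Λ := Finset.sum_nonneg fun _ _ => abs_nonneg _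
  have hΛ : ∀ ℓ, |lam ℓ 0| ≤ Λ := fun ℓ =>
    Finset.single_le_sum (f := fun ℓ => |lam ℓ 0|) (fun _ _ => abs_nonneg _) (Finset.mem_univ ℓ)
  have hβ0 : 0 ≤ ∑ l, |β l| := Finset.sum_nonneg fun _ _ => abs_nonneg _
  have key : ∀ s : ℝ, 0 < s → s * ‖∑ l, (β l : ℂ) • Q.AOp l x‖
      ≤ (2 * Λ + s * (K * ∑ l, |β l|)) * ‖x‖ := by
    intro s hs
    have e := Q.toEuclideanLin_L_add 0 0 (s • β) x
    have e2 : ∑ l, ((s • β) l : ℂ) • Q.AOp l x = (s : ℂ) • ∑ l, (β l : ℂ) • Q.AOp l x := by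
      rw [Finset.smul_sum]
      refine Finset.sum_congr rfl fun l _ => ?_
      rw [smul_smul]; simp
    rw [e2, zero_add, Complex.ofReal_zero, zero_smul, sub_zero] at e
    have e3 : (s : ℂ) • ∑ l, (β l : ℂ) • Q.AOp l x = Matrix.toEuclideanLin (Q.L 0 (s • β)) x
        - Matrix.toEuclideanLin (Q.L 0 0) x := by rw [← e]; abel
    have h1 := hS.norm_toEuclideanLin_L_le 0 hΛ hΛ0 x
    have h2 := hS.norm_toEuclideanLin_L_le (s • β) (μ := Λ + s * (K * ∑ l, |β l|))
      (fun ℓ => by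
        have hl := hS.lipschitz ℓ 0 (s • β)
        have : ∑ l, |(s • β) l - (0 : Rd d) l| = s * ∑ l, |β l| := by
          rw [Finset.mul_sum]
          refine Finset.sum_congr rfl fun l _ => ?_
          simp [abs_mul, abs_of_pos hs]
        rw [this] at hl
        have h3 := abs_sub_abs_le_abs_sub (lam ℓ (s • β)) (lam ℓ 0)
        have h4 := hΛ ℓ
        linarith) (by positivity) x
    have h5 : ‖(s : ℂ) • ∑ l, (β l : ℂ) • Q.AOp l x‖ = s * ‖∑ l, (β l : ℂ) • Q.AOp l x‖ := by
      rw [norm_smul, Complex.norm_real, Real.norm_of_nonneg hs.le]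
    rw [← h5, e3]
    refine (norm_sub_le _ _).trans ?_
    linarith
  by_contra! hlt
  set X := ‖∑ l, (β l : ℂ) • Q.AOp l x‖
  set Y := K * (∑ l, |β l|) * ‖x‖
  have hpos : 0 < X - Y := sub_pos.2 hlt
  have hz : 0 ≤ 2 * Λ * ‖x‖ := by positivity
  -- For this `s` one has `s(X - Y) = 2Λ‖x‖ + 1`, which exceeds the bound `2Λ‖x‖` given by `key`.
  have := key ((2 * Λ * ‖x‖ + 1) / (X - Y)) (by positivity)
  have h6 : (2 * Λ * ‖x‖ + 1) / (X - Y) * (X - Y) = 2 * Λ * ‖x‖ + 1 := by field_simp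
  nlinarith

end SmoothEigendecomposition

end LinearAlgebra

/-! ### Spectral projections on `W`. -/

theorem continuous_rankOne_self {E : Type*} [NormedAddCommGroup E] [InnerProductSpace ℂ E] :
    Continuous fun v : E => (InnerProductSpace.rankOne ℂ v v : E →L[ℂ] E) := by
  have h1 : Continuous fun v : E => innerSL ℂ v := (innerSL ℂ).continuous
  have h2 : Continuous fun v : E => ContinuousLinearMap.smulRightL ℂ E E (innerSL ℂ v) :=
    (ContinuousLinearMap.smulRightL ℂ E E).continuous.comp h1
  exact h2.clm_apply continuous_id

section Projections

variable {d n : ℕ} {Q : HypSystem d n} {K : ℝ} {lam : Fin n → Rd d → ℝ}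
  {psi : Fin n → Rd d → Cn n}

/-- The orthogonal projection onto the `ℓ`-th eigenvector of `L(0, jκ + εk)`. -/
noncomputable def projSym (psi : Fin n → Rd d → Cn n) (κ : Rd d) (j : ℕ) (ε : ℝ) (ℓ : Fin n)
    (k : Rd d) : Cn n →L[ℂ] Cn n :=
  InnerProductSpace.rankOne ℂ (psi ℓ ((j : ℝ) • κ + ε • k)) (psi ℓ ((j : ℝ) • κ + ε • k))

/-- The oscillation frequency `λ_{jℓ}(εk)/ε`. -/
noncomputable def freq (lam : Fin n → Rd d → ℝ) (κ : Rd d) (ω : ℝ) (j : ℕ) (ε : ℝ) (ℓ : Fin n)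
    (k : Rd d) : ℝ := lamJ κ ω lam j ℓ (ε • k) / ε

namespace SmoothEigendecomposition

theorem measurable_psi (hS : SmoothEigendecomposition Q K lam psi)
    (ℓ : Fin n) : Measurable (psi ℓ) :=
  measurable_of_continuousOn_compl_singleton 0 (hS.smooth_psi ℓ).continuousOn

theorem measurable_lam (hS : SmoothEigendecomposition Q K lam psi)
    (ℓ : Fin n) : Measurable (lam ℓ) :=
  measurable_of_continuousOn_compl_singleton 0 (hS.smooth_lam ℓ).continuousOn

theorem measurable_freq (hS : SmoothEigendecomposition Q K lam psi)
    (κ : Rd d) (ω : ℝ) (j : ℕ) (ε : ℝ) (ℓ : Fin n) :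
    Measurable (freq lam κ ω j ε ℓ) := by
  have h : Measurable fun k : Rd d => lam ℓ ((j : ℝ) • κ + ε • k) :=
    (hS.measurable_lam ℓ).comp (by fun_prop)
  exact (h.sub_const _).div_const _

theorem aestronglyMeasurable_projSym (hS : SmoothEigendecomposition Q K lam psi)
    (κ : Rd d) (j : ℕ) (ε : ℝ) (ℓ : Fin n) :
    AEStronglyMeasurable (projSym psi κ j ε ℓ) := by
  have h : Measurable fun k : Rd d => psi ℓ ((j : ℝ) • κ + ε • k) :=
    (hS.measurable_psi ℓ).comp (by fun_prop)
  exact continuous_rankOne_self.comp_aestronglyMeasurable h.aestronglyMeasurable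

theorem norm_projSym_le (hS : SmoothEigendecomposition Q K lam psi)
    (κ : Rd d) (j : ℕ) (ε : ℝ) (ℓ : Fin n) (k : Rd d) :
    ‖projSym psi κ j ε ℓ k‖ ≤ 1 := by
  rw [projSym, InnerProductSpace.norm_rankOne, (hS.orthonormal _).1 ℓ, one_mul]

/-- The spectral projection of `u_j` onto the `ℓ`-th branch. -/
noncomputable def projW (hS : SmoothEigendecomposition Q K lam psi)
    (κ : Rd d) (j : ℕ) (ε : ℝ) (ℓ : Fin n) : Wiener d n →L[ℝ] Wiener d n :=
  Wiener.mulOp (projSym psi κ j ε ℓ) (hS.aestronglyMeasurable_projSym κ j ε ℓ) 1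
    (hS.norm_projSym_le κ j ε ℓ)

variable (κ : Rd d) (j : ℕ) (ε : ℝ) (ℓ : Fin n)

theorem coeFn_projW (hS : SmoothEigendecomposition Q K lam psi)
    (f : Wiener d n) :
    hS.projW κ j ε ℓ f =ᵐ[volume] fun k => inner ℂ (psi ℓ ((j : ℝ) • κ + ε • k)) (f k) •
      psi ℓ ((j : ℝ) • κ + ε • k) :=
  Wiener.coeFn_mulOp f

theorem norm_projW_le (hS : SmoothEigendecomposition Q K lam psi)
    (f : Wiener d n) : ‖hS.projW κ j ε ℓ f‖ ≤ ‖f‖ :=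
  (Wiener.norm_mulOp_le f).trans_eq (one_mul _)

theorem isDer_projW (hS : SmoothEigendecomposition Q K lam psi)
    {l : Fin d} {f g : Wiener d n} (h : Wiener.IsDer l f g) :
    Wiener.IsDer l (hS.projW κ j ε ℓ f) (hS.projW κ j ε ℓ g) := h.mulOp

theorem sum_projW (hS : SmoothEigendecomposition Q K lam psi)
    (f : Wiener d n) : ∑ ℓ, hS.projW κ j ε ℓ f = f := by
  refine Lp.ext ?_
  have h : ∀ᵐ k : Rd d, ∀ ℓ : Fin n, hS.projW κ j ε ℓ f k
      = inner ℂ (psi ℓ ((j : ℝ) • κ + ε • k)) (f k) • psi ℓ ((j : ℝ) • κ + ε • k) :=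
    ae_all_iff.2 fun ℓ => hS.coeFn_projW κ j ε ℓ f
  filter_upwards [h, Lp.coeFn_finsetSum Finset.univ (fun ℓ => hS.projW κ j ε ℓ f)] with k h1 h2
  rw [h2, Finset.sum_apply]
  simp only [h1]
  exact hS.sum_inner_smul _ _

theorem norm_le_sum_projW (hS : SmoothEigendecomposition Q K lam psi)
    (f : Wiener d n) : ‖f‖ ≤ ∑ ℓ, ‖hS.projW κ j ε ℓ f‖ := by
  conv_lhs => rw [← hS.sum_projW κ j ε f]
  exact norm_sum_le _ _

theorem norm_sub_projW_le (hS : SmoothEigendecomposition Q K lam psi)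
    (f : Wiener d n) :
    ‖f - hS.projW κ j ε ℓ f‖ ≤ ∑ ℓ' ∈ Finset.univ.erase ℓ, ‖hS.projW κ j ε ℓ' f‖ := by
  have : f - hS.projW κ j ε ℓ f = ∑ ℓ' ∈ Finset.univ.erase ℓ, hS.projW κ j ε ℓ' f := by
    have h := Finset.add_sum_erase Finset.univ (fun ℓ' => hS.projW κ j ε ℓ' f) (Finset.mem_univ ℓ)
    rw [hS.sum_projW κ j ε f] at h
    exact sub_eq_of_eq_add' h.symm
  rw [this]
  exact norm_sum_le _ _

/-- The argument moves by `εk`, so the Lipschitz bound supplies a factor `ε` that cancels the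
division by `ε`. Freezing the frequency at `k = 0` therefore costs one derivative, uniformly in `ε`.
-/
theorem abs_freq_sub_le (hS : SmoothEigendecomposition Q K lam psi)
    (ω : ℝ) (hε : 0 < ε) (k : Rd d) :
    |freq lam κ ω j ε ℓ k - lamJ κ ω lam j ℓ 0 / ε| ≤ K * ∑ l, |k l| := by
  have h := hS.lipschitz ℓ ((j : ℝ) • κ + 0) ((j : ℝ) • κ + ε • k)
  have e : ∑ l, |((j : ℝ) • κ + ε • k) l - ((j : ℝ) • κ + 0) l| = ε * ∑ l, |k l| := by
    rw [Finset.mul_sum]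
    refine Finset.sum_congr rfl fun l _ => ?_
    simp [abs_mul, abs_of_pos hε]
  rw [e] at h
  unfold freq lamJ
  rw [← sub_div, abs_div, abs_of_pos hε, div_le_iff₀ hε, sub_sub_sub_cancel_right]
  linarith

end SmoothEigendecomposition

/-- A multiplier with linear growth acts on functions with derivatives in `W`. -/
theorem Wiener.exists_mul_of_isDer {φ : Rd d → ℝ} (hφ : Measurable φ) {K : ℝ}
    (hK : ∀ k, |φ k| ≤ K * ∑ l, |k l|) {f : Wiener d n} {fl : Fin d → Wiener d n}
    (hf : ∀ l, IsDer l f (fl l)) :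
    ∃ q : Wiener d n, (∀ᵐ k, q k = (Complex.I * (φ k : ℂ)) • f k) ∧ ‖q‖ ≤ K * ∑ l, ‖fl l‖ := by
  have hpt : ∀ᵐ k, ‖(Complex.I * (φ k : ℂ)) • f k‖ ≤ K * ∑ l, ‖fl l k‖ := by
    filter_upwards [ae_all_iff.2 hf] with k hk
    have e : ∑ l, ‖fl l k‖ = (∑ l, |k l|) * ‖f k‖ := by
      rw [Finset.sum_mul]
      refine Finset.sum_congr rfl fun l _ => ?_
      rw [hk l, norm_smul]; simp
    rw [e, norm_smul, ← mul_assoc]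
    gcongr
    simpa using hK k
  have hInt : Integrable fun k => K * ∑ l, ‖fl l k‖ :=
    (integrable_finsetSum _ fun l _ => (integrable (fl l)).norm).const_mul K
  have hq : Integrable fun k => (Complex.I * (φ k : ℂ)) • f k := by
    refine hInt.mono' ?_ hpt
    exact AEStronglyMeasurable.smul (by fun_prop : Measurable fun k =>
      Complex.I * (φ k : ℂ)).aestronglyMeasurable (integrable f).aestronglyMeasurable
  refine ⟨hq.toL1 _, hq.coeFn_toL1, ?_⟩
  have hle : ‖hq.toL1 _‖ ≤ ∫ k, K * ∑ l, ‖fl l k‖ := by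
    refine norm_le_of_ae hInt ?_
    filter_upwards [hq.coeFn_toL1, hpt] with k h1 h2
    rw [h1]; exact h2
  refine hle.trans_eq ?_
  rw [integral_const_mul, integral_finsetSum _ fun l _ => (integrable (fl l)).norm]
  simp only [L1.norm_eq_integral_norm]

end Projections

/-! ### The envelope equation in Fourier space. -/

section FourierEquation

variable {d n : ℕ} {Q : HypSystem d n} {K : ℝ} {lam : Fin n → Rd d → ℝ}
  {psi : Fin n → Rd d → Cn n}

/-- The envelope equation in Fourier space. -/
theorem EnvelopeEq.fourier {κ : Rd d} {ω ε : ℝ} {u₁ u₃ w w' : Wiener d n} {j : ℤ}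
    (hw : Wiener.MemW1 w) (h : ∀ x, EnvelopeEq Q κ ω ε u₁ u₃ j w w' x) :
    ∀ᵐ k : Rd d, w' k + (Complex.I / (ε : ℂ)) •
        Matrix.toEuclideanLin (Q.L (j * ω) ((j : ℝ) • κ)) (w k)
      + ∑ l, (Complex.I * (k l : ℂ)) • Q.AOp l (w k)
      = (ε : ℂ) • Q.nonlin (modeW u₁ u₃) j k := by
  let LC : Cn n →L[ℂ] Cn n :=
    LinearMap.toContinuousLinearMap (Matrix.toEuclideanLin (Q.L (j * ω) ((j : ℝ) • κ)))
  let AC : Fin d → Cn n →L[ℂ] Cn n := fun l => LinearMap.toContinuousLinearMap (Q.AOp l)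
  have key : w' + (Complex.I / (ε : ℂ)) • LC.compLp w + ∑ l, (AC l).compLp (Wiener.partialD l w)
      = (ε : ℂ) • Q.nonlin (modeW u₁ u₃) j := by
    refine Wiener.eval_injective fun x => ?_
    have hx := h x
    unfold EnvelopeEq at hx
    simp only [← Wiener.evalₗ_apply, map_add, map_smul, map_sum]
    simp only [Wiener.evalₗ_apply, Wiener.eval_compLp, HypSystem.eval_nonlin, eval_modeW]
    rw [← hx]
    simp only [hw.lineDeriv_eval]
    rfl
  have hsum := Lp.coeFn_finsetSum Finset.univ (fun l => (AC l).compLp (Wiener.partialD l w))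
  have hA : ∀ᵐ k : Rd d, ∀ l, (AC l).compLp (Wiener.partialD l w) k = AC l (Wiener.partialD l w k) :=
    ae_all_iff.2 fun l => (AC l).coeFn_compLp _
  have hD : ∀ᵐ k : Rd d, ∀ l, Wiener.partialD l w k = (Complex.I * (k l : ℂ)) • w k :=
    ae_all_iff.2 fun l => hw.isDer_partialD l
  filter_upwards [hsum, hA, hD, LC.coeFn_compLp w,
    Lp.coeFn_add (w' + (Complex.I / (ε : ℂ)) • LC.compLp w)
      (∑ l, (AC l).compLp (Wiener.partialD l w)),
    Lp.coeFn_add w' ((Complex.I / (ε : ℂ)) • LC.compLp w),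
    Lp.coeFn_smul (Complex.I / (ε : ℂ)) (LC.compLp w),
    Lp.coeFn_smul (ε : ℂ) (Q.nonlin (modeW u₁ u₃) j)] with k h1 h2 h3 h4 h5 h6 h7 h8
  have hk := congrArg (fun F : Wiener d n => F k) key
  simp only [h5, h6, h7, h8, h4, h1, h2, h3, map_smul, Pi.add_apply, Pi.smul_apply,
    Finset.sum_apply] at hk
  exact hk

/-- The scalar transport equation for each spectral component. -/
theorem SmoothEigendecomposition.projW_eq (hS : SmoothEigendecomposition Q K lam psi) {κ : Rd d}
    {ω ε : ℝ} (hε : 0 < ε) {u₁ u₃ w w' : Wiener d n} (j : ℕ) (hw : Wiener.MemW1 w)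
    (h : ∀ x, EnvelopeEq Q κ ω ε u₁ u₃ (j : ℤ) w w' x) (ℓ : Fin n) :
    ∀ᵐ k : Rd d, hS.projW κ j ε ℓ w' k
      = -(Complex.I * (freq lam κ ω j ε ℓ k : ℂ)) • hS.projW κ j ε ℓ w k
        + (ε • hS.projW κ j ε ℓ (Q.nonlin (modeW u₁ u₃) j) : Wiener d n) k := by
  have hεC : (ε : ℂ) ≠ 0 := by exact_mod_cast hε.ne'
  filter_upwards [EnvelopeEq.fourier hw h, hS.coeFn_projW κ j ε ℓ w', hS.coeFn_projW κ j ε ℓ w,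
    hS.coeFn_projW κ j ε ℓ (Q.nonlin (modeW u₁ u₃) j),
    Lp.coeFn_smul ε (hS.projW κ j ε ℓ (Q.nonlin (modeW u₁ u₃) j))] with k h1 h2 h3 h4 h5
  rw [h5, Pi.smul_apply, h2, h3, h4]
  set β := (j : ℝ) • κ + ε • k with hβ
  set v := psi ℓ β
  have e1 := Q.toEuclideanLin_L_add (j * ω) ((j : ℝ) • κ) (ε • k) (w k)
  rw [← hβ] at e1
  -- The symbol of `A(∂)` is `iA(k) = (i/ε)A(εk)`, so it joins `(i/ε)L(jω, jκ)` to form `(i/ε)(L(0,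
  -- jκ + εk) - jω)`.
  have e2 : ∑ l, ((ε • k) l : ℂ) • Q.AOp l (w k)
      = ((ε : ℂ) / Complex.I) • ∑ l, (Complex.I * (k l : ℂ)) • Q.AOp l (w k) := by
    rw [Finset.smul_sum]
    refine Finset.sum_congr rfl fun l _ => ?_
    rw [smul_smul]
    congr 1
    simp only [PiLp.smul_apply, smul_eq_mul, Complex.ofReal_mul]
    field_simp
  rw [e2] at e1
  have e3 : w' k = -((Complex.I / (ε : ℂ)) • (Matrix.toEuclideanLin (Q.L 0 β) (w k)
      - ((j * ω : ℝ) : ℂ) • w k)) + (ε : ℂ) • Q.nonlin (modeW u₁ u₃) j k := by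
    rw [← e1, ← h1, smul_add, smul_smul]
    have : Complex.I / (ε : ℂ) * ((ε : ℂ) / Complex.I) = 1 := by
      field_simp
    rw [this, one_smul]
    simp only [Int.cast_natCast]
    abel
  have e4 : inner ℂ v (w' k) = -(Complex.I * (freq lam κ ω j ε ℓ k : ℂ)) * inner ℂ v (w k)
      + (ε : ℂ) * inner ℂ v (Q.nonlin (modeW u₁ u₃) j k) := by
    have e6 : inner ℂ v (Matrix.toEuclideanLin (Q.L 0 β) (w k)) = (lam ℓ β : ℂ) * inner ℂ v (w k) :=
      Q.inner_toEuclideanLin_L (hS.eigen ℓ β) _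
    rw [e3, inner_add_right, inner_neg_right, inner_smul_right, inner_sub_right, e6,
      inner_smul_right, inner_smul_right]
    have e5 : (freq lam κ ω j ε ℓ k : ℂ) = ((lam ℓ β : ℂ) - ((j * ω : ℝ) : ℂ)) / (ε : ℂ) := by
      unfold freq lamJ; push_cast; rfl
    rw [e5]
    field_simp
  rw [e4, add_smul, mul_smul, mul_smul, ← Complex.coe_smul ε]

end FourierEquation

/-! ### Uniform bound in `W¹`. -/

section SobolevBound

variable {d n : ℕ} {Q : HypSystem d n} {K : ℝ} {lam : Fin n → Rd d → ℝ}
  {psi : Fin n → Rd d → Cn n}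

theorem ClassicalRegularity.hasDerivAt {τ : ℝ} {w : ℝ → Wiener d n}
    (h : ClassicalRegularity τ w) {t : ℝ} (ht : t ∈ Ioo 0 τ) :
    HasDerivAt w (derivWithin w (Icc 0 τ) t) t :=
  (((h.contDiffOn.differentiableOn one_ne_zero) t
    (Ioo_subset_Icc_self ht)).hasDerivWithinAt).hasDerivAt (Icc_mem_nhds ht.1 ht.2)

theorem ClassicalRegularity.continuousOn_normW1 {τ : ℝ} {w : ℝ → Wiener d n}
    (h : ClassicalRegularity τ w) : ContinuousOn (fun t => Wiener.normW1 (w t)) (Icc 0 τ) :=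
  h.contDiffOn.continuousOn.norm.add
    (continuousOn_finsetSum _ fun l _ => (h.continuousOn_partial l).norm)

namespace Wiener

theorem normW1_nonneg (f : Wiener d n) : 0 ≤ normW1 f :=
  add_nonneg (norm_nonneg _) (Finset.sum_nonneg fun _ _ => norm_nonneg _)

theorem norm_le_normW1 (f : Wiener d n) : ‖f‖ ≤ normW1 f :=
  le_add_of_nonneg_right (Finset.sum_nonneg fun _ _ => norm_nonneg _)

theorem sum_norm_partialD_le_normW1 (f : Wiener d n) : ∑ l, ‖partialD l f‖ ≤ normW1 f :=
  le_add_of_nonneg_left (norm_nonneg _)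

theorem norm_partialD_le_normW1 (f : Wiener d n) (l : Fin d) : ‖partialD l f‖ ≤ normW1 f :=
  (Finset.single_le_sum (f := fun l => ‖partialD l f‖) (fun _ _ => norm_nonneg _)
    (Finset.mem_univ l)).trans (sum_norm_partialD_le_normW1 f)

theorem normW1_zero (h : MemW1 (0 : Wiener d n)) : normW1 (0 : Wiener d n) = 0 := by
  have hl : ∀ l, partialD l (0 : Wiener d n) = 0 := fun l => by
    rw [Lp.eq_zero_iff_ae_eq_zero]
    filter_upwards [h.isDer_partialD l, Lp.coeFn_zero (Cn n) 1 (volume : Measure (Rd d))]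
      with k h1 h2
    rw [h1, h2, Pi.zero_apply, smul_zero]
  simp [normW1, hl]

end Wiener

/-- Growth of the `W¹` norm of a mode under a bound of the nonlinearity in `W¹`. -/
theorem SmoothEigendecomposition.normW1_le (hS : SmoothEigendecomposition Q K lam psi) {κ : Rd d}
    {ω ε : ℝ} (hε : 0 < ε) {u₁ u₃ w : ℝ → Wiener d n} (j : ℕ) {τ T c : ℝ} (hTτ : T ≤ τ)
    (h₁ : ClassicalRegularity τ u₁) (h₃ : ClassicalRegularity τ u₃) (hw : ClassicalRegularity τ w)
    (heq : ∀ t ∈ Ioc 0 τ, ∀ x,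
      EnvelopeEq Q κ ω ε (u₁ t) (u₃ t) (j : ℤ) (w t) (derivWithin w (Icc 0 τ) t) x)
    (hN : ∀ t ∈ Ioo 0 T, ‖Q.nonlin (modeW (u₁ t) (u₃ t)) j‖ ≤ c)
    (hD : ∀ t ∈ Ioo 0 T, ∀ l, ‖Q.nonlinD (modeW (u₁ t) (u₃ t))
      (modeW (Wiener.partialD l (u₁ t)) (Wiener.partialD l (u₃ t))) j‖ ≤ c) :
    ∀ t ∈ Icc 0 T, Wiener.normW1 (w t) ≤ n * (Wiener.normW1 (w 0) + (d + 1) * (ε * c * t)) := by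
  intro t ht
  have hsub : ∀ s ∈ Ioo 0 T, s ∈ Ioo 0 τ := fun s hs => ⟨hs.1, hs.2.trans_le hTτ⟩
  have hcont : ∀ ℓ, ContinuousOn (fun s => hS.projW κ j ε ℓ (w s)) (Icc 0 T) := fun ℓ =>
    (hS.projW κ j ε ℓ).continuous.comp_continuousOn
      (hw.contDiffOn.continuousOn.mono (Icc_subset_Icc_right hTτ))
  have hder : ∀ ℓ, ∀ s ∈ Ioo 0 T, HasDerivAt (fun s => hS.projW κ j ε ℓ (w s))
      (hS.projW κ j ε ℓ (derivWithin w (Icc 0 τ) s)) s := fun ℓ s hs =>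
    (hS.projW κ j ε ℓ).hasFDerivAt.comp_hasDerivAt s (hw.hasDerivAt (hsub s hs))
  have hpde : ∀ ℓ, ∀ s ∈ Ioo 0 T, _ := fun ℓ s hs =>
    hS.projW_eq hε j (hw.memW1 s (Ioo_subset_Icc_self (hsub s hs)))
      (heq s (Ioo_subset_Ioc_self (hsub s hs))) ℓ
  have hIcc : ∀ s ∈ Icc 0 T, s ∈ Icc 0 τ := fun s hs => ⟨hs.1, hs.2.trans hTτ⟩
  have b0 : ∀ ℓ, ‖hS.projW κ j ε ℓ (w t)‖ ≤ ‖w 0‖ + ε * c * t := fun ℓ => by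
    have := norm_le_of_transport (hS.measurable_freq κ ω j ε ℓ) (c := ε * c) (hcont ℓ) (hder ℓ)
      (hpde ℓ) (fun s hs => by
        rw [norm_smul, Real.norm_of_nonneg hε.le]
        gcongr
        exact (hS.norm_projW_le κ j ε ℓ _).trans (hN s hs)) t ht
    exact this.trans (by gcongr; exact hS.norm_projW_le κ j ε ℓ _)
  have b1 : ∀ l ℓ, ‖hS.projW κ j ε ℓ (Wiener.partialD l (w t))‖
      ≤ ‖Wiener.partialD l (w 0)‖ + ε * c * t := fun l ℓ => by
    have := norm_der_le_of_transport (hS.measurable_freq κ ω j ε ℓ) (c := ε * c) (l := l)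
      (al := fun s => hS.projW κ j ε ℓ (Wiener.partialD l (w s)))
      (fl := fun s => (ε : ℂ) • hS.projW κ j ε ℓ (Q.nonlinD (modeW (u₁ s) (u₃ s))
        (modeW (Wiener.partialD l (u₁ s)) (Wiener.partialD l (u₃ s))) j))
      (hcont ℓ) (hder ℓ)
      (hpde ℓ)
      (fun s hs => hS.isDer_projW κ j ε ℓ ((hw.memW1 s (hIcc s hs)).isDer_partialD l))
      (fun s hs => by
        have hs' := Ioo_subset_Icc_self (hsub s hs)
        have := (hS.isDer_projW κ j ε ℓ (Q.isDer_nonlin (fun i =>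
          ((h₁.memW1 s hs').isDer_partialD l).modeW ((h₃.memW1 s hs').isDer_partialD l) i)
          j)).const_smul (ε : ℂ)
        rwa [Complex.coe_smul] at this)
      (fun s hs => by
        rw [norm_smul, Complex.norm_real, Real.norm_of_nonneg hε.le]
        gcongr
        exact (hS.norm_projW_le κ j ε ℓ _).trans (hD s hs l)) t ht
    exact this.trans (by gcongr; exact hS.norm_projW_le κ j ε ℓ _)
  have s0 : ‖w t‖ ≤ n * (‖w 0‖ + ε * c * t) :=
    (hS.norm_le_sum_projW κ j ε _).trans
      ((Finset.sum_le_sum fun ℓ _ => b0 ℓ).trans_eq (by simp [mul_add]))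
  have s1 : ∀ l, ‖Wiener.partialD l (w t)‖ ≤ n * (‖Wiener.partialD l (w 0)‖ + ε * c * t) :=
    fun l => (hS.norm_le_sum_projW κ j ε _).trans
      ((Finset.sum_le_sum fun ℓ _ => b1 l ℓ).trans_eq (by simp [mul_add]))
  -- The factor `n` comes from summing over the spectral branches, the factor `d + 1` from the
  -- function together with its `d` derivatives.
  unfold Wiener.normW1
  calc _ ≤ n * (‖w 0‖ + ε * c * t) + ∑ l : Fin d, n * (‖Wiener.partialD l (w 0)‖ + ε * c * t) :=
        add_le_add s0 (Finset.sum_le_sum fun l _ => s1 l)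
    _ = _ := by
        rw [← Finset.mul_sum, Finset.sum_add_distrib]
        simp
        ring

/-- Uniform `W¹` bound on the time scale `1/ε`. -/
theorem IsClassicalSolution.normW1_lt {κ : Rd d} {ω ε tend tstar M c B : ℝ}
    {p : Wiener d n} {u₁ u₃ : ℝ → Wiener d n}
    (hsol : IsClassicalSolution Q κ ω ε (tend / ε) p u₁ u₃)
    (hS : SmoothEigendecomposition Q K lam psi) (hε : 0 < ε)
    (hc : 0 ≤ c) (hT : ∀ f g h : Wiener d n, ‖Q.triW f g h‖ ≤ c * ‖f‖ * ‖g‖ * ‖h‖)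
    (hM : Wiener.normW1 p ≤ M) (htt : tstar ≤ tend) (hB : B = n * M + 1)
    (hsmall : tstar * (n * (2 * (d + 1) * (192 * (c * B ^ 3)))) < 1) :
    ∀ t ∈ Icc 0 (tstar / ε), Wiener.normW1 (u₁ t) + Wiener.normW1 (u₃ t) < B := by
  have hM0 : 0 ≤ M := (Wiener.normW1_nonneg p).trans hM
  have hB0 : 0 < B := by rw [hB]; positivity
  have hτ : tstar / ε ≤ tend / ε := by gcongr
  refine lt_of_bootstrap ((hsol.regular₁.continuousOn_normW1.add
    hsol.regular₃.continuousOn_normW1).mono (Icc_subset_Icc_right hτ)) fun t ht hbd => ?_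
  have hmode : ∀ s ∈ Ioo 0 t, ∀ i, ‖modeW (u₁ s) (u₃ s) i‖ ≤ B := fun s hs i =>
    (norm_modeW_le _ _ i).trans ((add_le_add (Wiener.norm_le_normW1 _)
      (Wiener.norm_le_normW1 _)).trans (hbd s ⟨hs.1.le, hs.2⟩))
  have hmodeD : ∀ s ∈ Ioo 0 t, ∀ l i,
      ‖modeW (Wiener.partialD l (u₁ s)) (Wiener.partialD l (u₃ s)) i‖ ≤ B := fun s hs l i =>
    (norm_modeW_le _ _ i).trans ((add_le_add (Wiener.norm_partialD_le_normW1 _ l)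
      (Wiener.norm_partialD_le_normW1 _ l)).trans (hbd s ⟨hs.1.le, hs.2⟩))
  -- The weaker constant `192` is used here so that the nonlinearity and its derivatives share one
  -- bound.
  have hN : ∀ j : ℤ, ∀ s ∈ Ioo 0 t, ‖Q.nonlin (modeW (u₁ s) (u₃ s)) j‖ ≤ 192 * (c * B ^ 3) :=
    fun j s hs => (Q.norm_nonlin_le hc hT (hmode s hs) j).trans (by
      have : 0 ≤ c * B ^ 3 := by positivity
      linarith)
  have hD : ∀ j : ℤ, ∀ s ∈ Ioo 0 t, ∀ l, ‖Q.nonlinD (modeW (u₁ s) (u₃ s))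
      (modeW (Wiener.partialD l (u₁ s)) (Wiener.partialD l (u₃ s))) j‖ ≤ 192 * (c * B ^ 3) :=
    fun j s hs l => (Q.norm_nonlinD_le hc hT (hmode s hs) (hmodeD s hs l) j).trans_eq (by ring)
  have e1 := hS.normW1_le hε 1 (ht.2.trans hτ) hsol.regular₁ hsol.regular₃ hsol.regular₁
    hsol.eq₁ (hN 1) (hD 1) t ⟨ht.1, le_rfl⟩
  have e3 := hS.normW1_le hε 3 (ht.2.trans hτ) hsol.regular₁ hsol.regular₃ hsol.regular₃
    hsol.eq₃ (hN 3) (hD 3) t ⟨ht.1, le_rfl⟩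
  have hzero : Wiener.normW1 (u₃ 0) = 0 := by
    have h0 : (0 : ℝ) ∈ Icc 0 (tend / ε) := ⟨le_rfl, ht.1.trans (ht.2.trans hτ)⟩
    have := hsol.regular₃.memW1 0 h0
    rw [hsol.init₃] at this ⊢
    exact Wiener.normW1_zero this
  rw [hsol.init₁] at e1
  rw [hzero] at e3
  have hεt : ε * t ≤ tstar := by
    have := (le_div_iff₀ hε).1 ht.2
    linarith
  have hfac : 0 ≤ n * (2 * (d + 1) * (192 * (c * B ^ 3))) := by positivity
  have hlin := mul_le_mul_of_nonneg_right hεt hfac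
  have hnM : n * Wiener.normW1 p ≤ n * M := by gcongr
  -- The data contribute at most `nM`; the forcing of the two modes contributes less than `1` by the
  -- choice of `tstar`. This is why `B = nM + 1`.
  calc _ ≤ _ := add_le_add e1 e3
    _ = n * Wiener.normW1 p + ε * t * (n * (2 * (d + 1) * (192 * (c * B ^ 3)))) := by ring
    _ < B := by rw [hB] at *; linarith

end SobolevBound

/-! ### Nonresonant components: initial size and normal form. -/

section NonresonantModes

variable {d n : ℕ} {Q : HypSystem d n} {K : ℝ} {lam : Fin n → Rd d → ℝ}
  {psi : Fin n → Rd d → Cn n}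

theorem HypSystem.continuousOn_triW (Q : HypSystem d n) {f g h : ℝ → Wiener d n} {s : Set ℝ}
    (hf : ContinuousOn f s) (hg : ContinuousOn g s) (hh : ContinuousOn h s) :
    ContinuousOn (fun t => Q.triW (f t) (g t) (h t)) s := by
  have h1 := ((convL1 (V := Rd d) Q.TCL).continuous.comp_continuousOn hf).clm_apply hg
  have h2 := ((convL1 (V := Rd d) (ContinuousLinearMap.id ℂ
    (Cn n →L[ℂ] Cn n))).continuous.comp_continuousOn h1).clm_apply hh
  exact h2.const_smul ((Wiener.evalConst d : ℂ) ^ 2)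

theorem HypSystem.continuousOn_nonlin (Q : HypSystem d n) {m : ℝ → ℤ → Wiener d n} {s : Set ℝ}
    (h : ∀ i, ContinuousOn (fun t => m t i) s) (j : ℤ) :
    ContinuousOn (fun t => Q.nonlin (m t) j) s :=
  continuousOn_finsetSum _ fun _ _ => Q.continuousOn_triW (h _) (h _) (h _)

theorem continuousOn_modeW {u₁ u₃ : ℝ → Wiener d n} {s : Set ℝ} (h₁ : ContinuousOn u₁ s)
    (h₃ : ContinuousOn u₃ s) (j : ℤ) : ContinuousOn (fun t => modeW (u₁ t) (u₃ t) j) s := by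
  unfold modeW
  split_ifs
  · exact h₁
  · exact h₃
  · exact Wiener.conjW.continuous.comp_continuousOn h₁
  · exact Wiener.conjW.continuous.comp_continuousOn h₃
  · exact continuousOn_const

/-- A constant matrix commutes with the Fourier transform, so polarization in `x` is polarization in
`k`. -/
theorem PolarizationAssumption.ae_mem_ker {κ : Rd d} {ω : ℝ} {p : Wiener d n}
    (hp : PolarizationAssumption Q κ ω p) :
    ∀ᵐ k : Rd d, Matrix.toEuclideanLin (Q.L ω κ) (p k) = 0 := by
  let LC : Cn n →L[ℂ] Cn n := LinearMap.toContinuousLinearMap (Matrix.toEuclideanLin (Q.L ω κ))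
  have h0 : LC.compLp p = 0 := Wiener.eq_zero_of_eval_eq_zero fun x => by
    rw [Wiener.eval_compLp]
    exact LinearMap.mem_ker.1 (hp.polarized x)
  filter_upwards [Lp.eq_zero_iff_ae_eq_zero.1 h0, LC.coeFn_compLp p] with k h1 h2
  rw [h2] at h1
  exact h1

namespace SmoothEigendecomposition

/-- Polarized initial data are `O(ε)` in the nonresonant components. -/
theorem norm_projW_initial_le (hS : SmoothEigendecomposition Q K lam psi)
    (hK : 0 ≤ K) {κ : Rd d} {ω ε G : ℝ} (hε : 0 < ε) {p : Wiener d n}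
    (hp : PolarizationAssumption Q κ ω p) (hp1 : Wiener.MemW1 p) {ℓ : Fin n}
    (hℓ : lamJ κ ω lam 1 ℓ 0 ≠ 0) (hG : |lamJ κ ω lam 1 ℓ 0|⁻¹ ≤ G) :
    ‖hS.projW κ 1 ε ℓ p‖ ≤ ε * (2 * G * K * Wiener.normW1 p) := by
  have hG0 : 0 ≤ G := (inv_nonneg.2 (abs_nonneg _)).trans hG
  have hInt : Integrable fun k => 2 * G * K * ε * ∑ l, ‖Wiener.partialD l p k‖ :=
    (integrable_finsetSum _ fun l _ => (Wiener.integrable (Wiener.partialD l p)).norm).const_mul _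
  have hle : ‖hS.projW κ 1 ε ℓ p‖ ≤ ∫ k, 2 * G * K * ε * ∑ l, ‖Wiener.partialD l p k‖ := by
    refine Wiener.norm_le_of_ae hInt ?_
    filter_upwards [hp.ae_mem_ker, hS.coeFn_projW κ 1 ε ℓ p,
      ae_all_iff.2 fun l => hp1.isDer_partialD l] with k h1 h2 h3
    have e0 : ∑ l, ‖Wiener.partialD l p k‖ = (∑ l, |k l|) * ‖p k‖ := by
      rw [Finset.sum_mul]
      refine Finset.sum_congr rfl fun l _ => ?_
      rw [h3 l, norm_smul]; simp
    have e1 := Q.toEuclideanLin_L_add ω κ (ε • k) (p k)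
    rw [h1, zero_add] at e1
    have hβ : (((1 : ℕ) : ℝ) • κ + ε • k) = κ + ε • k := by simp
    rw [hβ] at h2
    set v := psi ℓ (κ + ε • k) with hv
    have hv1 : ‖v‖ = 1 := (hS.orthonormal _).1 ℓ
    -- Since `L(ω, κ)p̂ = 0`, testing `A(εk)p̂` with the eigenvector `v` gives `(λ_ℓ(κ+εk) - ω)⟨v,
    -- p̂⟩`, which is therefore `O(ε|k|₁)`. Replacing the factor by its value at `k = 0` costs the
    -- same amount again, hence the `2`. No derivative of `ψ_ℓ` is needed.
    have e2 : inner ℂ v (∑ l, ((ε • k) l : ℂ) • Q.AOp l (p k))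
        = ((lam ℓ (κ + ε • k) - ω : ℝ) : ℂ) * inner ℂ v (p k) := by
      rw [e1, inner_sub_right, inner_smul_right,
        Q.inner_toEuclideanLin_L (hS.eigen ℓ (κ + ε • k))]
      push_cast
      ring
    have hS1 : ∑ l, |(ε • k) l| = ε * ∑ l, |k l| := by
      rw [Finset.mul_sum]
      refine Finset.sum_congr rfl fun l _ => ?_
      simp [abs_mul, abs_of_pos hε]
    have e3 : |lam ℓ (κ + ε • k) - ω| * ‖inner ℂ v (p k)‖
        ≤ K * (ε * ∑ l, |k l|) * ‖p k‖ := by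
      rw [← Real.norm_eq_abs, ← Complex.norm_real, ← norm_mul, ← e2]
      refine (norm_inner_le_norm _ _).trans ?_
      rw [hv1, one_mul, ← hS1]
      exact hS.norm_sum_AOp_le hK (ε • k) (p k)
    have e4 : |lamJ κ ω lam 1 ℓ 0| ≤ |lam ℓ (κ + ε • k) - ω| + K * (ε * ∑ l, |k l|) := by
      have h := hS.lipschitz ℓ κ (κ + ε • k)
      have : ∑ l, |(κ + ε • k) l - κ l| = ε * ∑ l, |k l| := by
        rw [← hS1]
        refine Finset.sum_congr rfl fun l _ => by simp
      rw [this] at h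
      have e : lamJ κ ω lam 1 ℓ 0 = (lam ℓ (κ + ε • k) - ω) - (lam ℓ (κ + ε • k) - lam ℓ κ) := by
        simp [lamJ]
      rw [e]
      exact (abs_sub _ _).trans (by linarith)
    have e5 : ‖inner ℂ v (p k)‖ ≤ ‖p k‖ := by
      have := norm_inner_le_norm (𝕜 := ℂ) v (p k)
      rwa [hv1, one_mul] at this
    have hk0 : 0 ≤ ∑ l, |k l| := Finset.sum_nonneg fun _ _ => abs_nonneg _
    have e6 : |lamJ κ ω lam 1 ℓ 0| * ‖inner ℂ v (p k)‖ ≤ 2 * (K * (ε * ∑ l, |k l|) * ‖p k‖) := by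
      have h7 := mul_le_mul_of_nonneg_right e4 (norm_nonneg (inner ℂ v (p k)))
      have h8 : K * (ε * ∑ l, |k l|) * ‖inner ℂ v (p k)‖ ≤ K * (ε * ∑ l, |k l|) * ‖p k‖ := by
        gcongr
      linarith
    rw [h2, norm_smul, hv1, mul_one, e0]
    calc ‖inner ℂ v (p k)‖
        = |lamJ κ ω lam 1 ℓ 0|⁻¹ * (|lamJ κ ω lam 1 ℓ 0| * ‖inner ℂ v (p k)‖) := by
          rw [inv_mul_cancel_left₀ (abs_ne_zero.2 hℓ)]
      _ ≤ G * (2 * (K * (ε * ∑ l, |k l|) * ‖p k‖)) := by gcongr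
      _ = _ := by ring
  refine hle.trans ?_
  rw [integral_const_mul, integral_finsetSum _ fun l _ =>
    (Wiener.integrable (Wiener.partialD l p)).norm]
  simp only [← L1.norm_eq_integral_norm]
  have := Wiener.sum_norm_partialD_le_normW1 p
  calc _ ≤ 2 * G * K * ε * Wiener.normW1 p := by gcongr
    _ = _ := by ring

/-- The resonant component of `u₁` varies slowly in time. -/
theorem norm_projW_deriv_le (hS : SmoothEigendecomposition Q K lam psi)
    (hK : 0 ≤ K) {κ : Rd d} {ω ε N : ℝ} (hε : 0 < ε) (hε1 : ε ≤ 1)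
    {u₁ u₃ w' : Wiener d n} {ℓ₁ : Fin n} (hℓ₁ : lamJ κ ω lam 1 ℓ₁ 0 = 0)
    (hu : Wiener.MemW1 u₁) (h : ∀ x, EnvelopeEq Q κ ω ε u₁ u₃ 1 u₁ w' x)
    (hN : ‖Q.nonlin (modeW u₁ u₃) 1‖ ≤ N) :
    ‖hS.projW κ 1 ε ℓ₁ w'‖ ≤ K * Wiener.normW1 u₁ + N := by
  -- Since `λ_{1ℓ₁}(0) = 0`, the frequency is bounded by `K|k|₁` and the `1/ε` oscillation is
  -- absent.
  obtain ⟨q, hq, hqn⟩ := Wiener.exists_mul_of_isDer (hS.measurable_freq κ ω 1 ε ℓ₁)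
    (fun k => by
      have := hS.abs_freq_sub_le κ 1 ε ℓ₁ ω hε k
      rwa [hℓ₁, zero_div, sub_zero] at this)
    (fun l => hS.isDer_projW κ 1 ε ℓ₁ (hu.isDer_partialD l))
  have e : hS.projW κ 1 ε ℓ₁ w' = ε • hS.projW κ 1 ε ℓ₁ (Q.nonlin (modeW u₁ u₃) 1) - q := by
    refine Lp.ext ?_
    filter_upwards [hS.projW_eq hε 1 hu h ℓ₁, hq,
      Lp.coeFn_sub (ε • hS.projW κ 1 ε ℓ₁ (Q.nonlin (modeW u₁ u₃) 1)) q] with k h1 h2 h3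
    rw [h1, h3, Pi.sub_apply, h2, neg_smul]
    simp only [Nat.cast_one]
    abel
  rw [e]
  have hN0 : 0 ≤ N := (norm_nonneg _).trans hN
  refine (norm_sub_le _ _).trans ?_
  have h1 : ‖ε • hS.projW κ 1 ε ℓ₁ (Q.nonlin (modeW u₁ u₃) 1)‖ ≤ N := by
    rw [norm_smul, Real.norm_of_nonneg hε.le]
    calc _ ≤ 1 * N := by
          gcongr
          exact (hS.norm_projW_le κ 1 ε ℓ₁ _).trans hN
      _ = N := one_mul N
  have h2 : K * ∑ l, ‖hS.projW κ 1 ε ℓ₁ (Wiener.partialD l u₁)‖ ≤ K * Wiener.normW1 u₁ := by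
    gcongr
    exact (Finset.sum_le_sum fun l _ => hS.norm_projW_le κ 1 ε ℓ₁ _).trans
      (Wiener.sum_norm_partialD_le_normW1 u₁)
  linarith

/-- Normal form estimate for a nonresonant component. -/
theorem norm_projW_le_of_nonresonant (hS : SmoothEigendecomposition Q K lam psi)
    (hK : 0 ≤ K) {κ : Rd d} {ω ε G c B η : ℝ} (hε : 0 < ε)
    (hε1 : ε ≤ 1) (hc : 0 ≤ c)
    (hT : ∀ f g h : Wiener d n, ‖Q.triW f g h‖ ≤ c * ‖f‖ * ‖g‖ * ‖h‖)
    {u₁ u₃ w : ℝ → Wiener d n} {j : ℕ} {ℓ ℓ₁ : Fin n} {τ T : ℝ} (hTτ : T ≤ τ)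
    (h₁ : ClassicalRegularity τ u₁) (hw : ClassicalRegularity τ w)
    (heq₁ : ∀ t ∈ Ioc 0 τ, ∀ x,
      EnvelopeEq Q κ ω ε (u₁ t) (u₃ t) 1 (u₁ t) (derivWithin u₁ (Icc 0 τ) t) x)
    (heq : ∀ t ∈ Ioc 0 τ, ∀ x,
      EnvelopeEq Q κ ω ε (u₁ t) (u₃ t) (j : ℤ) (w t) (derivWithin w (Icc 0 τ) t) x)
    (hℓ₁ : lamJ κ ω lam 1 ℓ₁ 0 = 0) (hℓ : lamJ κ ω lam j ℓ 0 ≠ 0)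
    (hG : |lamJ κ ω lam j ℓ 0|⁻¹ ≤ G)
    (hB : ∀ t ∈ Icc 0 T, Wiener.normW1 (u₁ t) + Wiener.normW1 (u₃ t) ≤ B)
    (hη : ∀ t ∈ Ioo 0 T, ‖u₁ t - hS.projW κ 1 ε ℓ₁ (u₁ t)‖ + ‖u₃ t‖ ≤ η) :
    ∀ t ∈ Icc 0 T, ‖hS.projW κ j ε ℓ (w t)‖ ≤ ‖hS.projW κ j ε ℓ (w 0)‖
      + 2 * (ε ^ 2 * G * (64 * (c * B ^ 3)))
      + (ε * (192 * c * B ^ 2 * η) + ε ^ 2 * G * (192 * c * B ^ 2 * (K * B + 64 * (c * B ^ 3))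
        + K * (d * (192 * c * B ^ 3)))) * t := by
  have hεC : (ε : ℂ) ≠ 0 := by exact_mod_cast hε.ne'
  have hlC : (lamJ κ ω lam j ℓ 0 : ℂ) ≠ 0 := by exact_mod_cast hℓ
  have hG0 : 0 ≤ G := (inv_nonneg.2 (abs_nonneg _)).trans hG
  set v : ℝ → Wiener d n := fun s => hS.projW κ 1 ε ℓ₁ (u₁ s) with hv
  set m : ℝ → ℤ → Wiener d n := fun s => modeW (u₁ s) (u₃ s) with hm
  set m₀ : ℝ → ℤ → Wiener d n := fun s => modeW (v s) 0 with hm₀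
  set m₀' : ℝ → ℤ → Wiener d n := fun s =>
    modeW (hS.projW κ 1 ε ℓ₁ (derivWithin u₁ (Icc 0 τ) s)) 0 with hm₀'
  set ml : Fin d → ℝ → ℤ → Wiener d n := fun l s =>
    modeW (hS.projW κ 1 ε ℓ₁ (Wiener.partialD l (u₁ s))) 0 with hml
  set P := hS.projW κ j ε ℓ with hP
  -- The forcing amplitude `ε` divided by `i` times the frozen frequency `λ_{jℓ}(0)/ε`.
  set μ : ℂ := (ε : ℂ) ^ 2 / (Complex.I * (lamJ κ ω lam j ℓ 0 : ℂ)) with hμ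
  have hμn : ‖μ‖ ≤ ε ^ 2 * G := by
    rw [hμ, norm_div, norm_mul, Complex.norm_I, one_mul, norm_pow, Complex.norm_real,
      Complex.norm_real, Real.norm_of_nonneg hε.le, Real.norm_eq_abs, div_eq_mul_inv]
    gcongr
  have hsub : ∀ s ∈ Ioo 0 T, s ∈ Ioo 0 τ := fun s hs => ⟨hs.1, hs.2.trans_le hTτ⟩
  have hu1 : ∀ s ∈ Icc 0 T, Wiener.normW1 (u₁ s) ≤ B := fun s hs => by
    have := hB s hs
    have := Wiener.normW1_nonneg (u₃ s)
    linarith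
  have nm : ∀ s ∈ Icc 0 T, ∀ i, ‖m s i‖ ≤ B := fun s hs i =>
    (norm_modeW_le _ _ i).trans ((add_le_add (Wiener.norm_le_normW1 _)
      (Wiener.norm_le_normW1 _)).trans (hB s hs))
  have nm₀ : ∀ s ∈ Icc 0 T, ∀ i, ‖m₀ s i‖ ≤ B := fun s hs i => by
    refine (norm_modeW_le _ _ i).trans ?_
    rw [norm_zero, add_zero]
    exact (hS.norm_projW_le κ 1 ε ℓ₁ _).trans ((Wiener.norm_le_normW1 _).trans (hu1 s hs))
  have nml : ∀ l, ∀ s ∈ Icc 0 T, ∀ i, ‖ml l s i‖ ≤ B := fun l s hs i => by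
    refine (norm_modeW_le _ _ i).trans ?_
    rw [norm_zero, add_zero]
    exact (hS.norm_projW_le κ 1 ε ℓ₁ _).trans
      ((Wiener.norm_partialD_le_normW1 _ l).trans (hu1 s hs))
  have nm₀' : ∀ s ∈ Ioo 0 T, ∀ i, ‖m₀' s i‖ ≤ K * B + 64 * (c * B ^ 3) := fun s hs i => by
    refine (norm_modeW_le _ _ i).trans ?_
    rw [norm_zero, add_zero]
    have hs' := Ioo_subset_Icc_self hs
    refine (hS.norm_projW_deriv_le hK hε hε1 hℓ₁ (h₁.memW1 s (Ioo_subset_Icc_self (hsub s hs)))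
      (heq₁ s (Ioo_subset_Ioc_self (hsub s hs)))
      (Q.norm_nonlin_le hc hT (nm s hs') 1)).trans ?_
    gcongr
    exact hu1 s hs'
  have hsubm : ∀ s ∈ Ioo 0 T, ∀ i, ‖m s i - m₀ s i‖ ≤ η := fun s hs i => by
    simp only [hm, hm₀]
    rw [modeW_sub, sub_zero]
    exact (norm_modeW_le _ _ i).trans (hη s hs)
  set b : ℝ → Wiener d n := fun s => P (Q.nonlin (m₀ s) j) with hb
  set b' : ℝ → Wiener d n := fun s => P (Q.nonlinD (m₀ s) (m₀' s) j) with hb'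
  have nb : ∀ s ∈ Icc 0 T, ‖b s‖ ≤ 64 * (c * B ^ 3) := fun s hs =>
    (hS.norm_projW_le κ j ε ℓ _).trans (Q.norm_nonlin_le hc hT (nm₀ s hs) j)
  have nb' : ∀ s ∈ Ioo 0 T, ‖b' s‖ ≤ 192 * c * B ^ 2 * (K * B + 64 * (c * B ^ 3)) := fun s hs =>
    (hS.norm_projW_le κ j ε ℓ _).trans ((Q.norm_nonlinD_le hc hT
      (nm₀ s (Ioo_subset_Icc_self hs)) (nm₀' s hs) j).trans_eq (by ring))
  -- The frozen frequency cancels `εb` exactly; `q` is the error from freezing, bounded by the first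
  -- derivatives of `b`.
  have hq : ∀ s ∈ Ioo 0 T, ∃ q : Wiener d n,
      (∀ᵐ k, q k = (Complex.I * ((freq lam κ ω j ε ℓ k - lamJ κ ω lam j ℓ 0 / ε : ℝ) : ℂ)) • b s k)
        ∧ ‖q‖ ≤ K * (d * (192 * c * B ^ 3)) := fun s hs => by
    have hs' := Ioo_subset_Icc_self hs
    obtain ⟨q, hq1, hq2⟩ := Wiener.exists_mul_of_isDer
      ((hS.measurable_freq κ ω j ε ℓ).sub_const (lamJ κ ω lam j ℓ 0 / ε))
      (hS.abs_freq_sub_le κ j ε ℓ ω hε) (f := b s)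
      (fl := fun l => P (Q.nonlinD (m₀ s) (ml l s) j))
      (fun l => hS.isDer_projW κ j ε ℓ (Q.isDer_nonlin (fun i => Wiener.IsDer.modeW
        (hS.isDer_projW κ 1 ε ℓ₁
          ((h₁.memW1 s (Ioo_subset_Icc_self (hsub s hs))).isDer_partialD l)) .zero i) j))
    refine ⟨q, hq1, hq2.trans ?_⟩
    gcongr
    calc _ ≤ ∑ _l : Fin d, 192 * c * B ^ 3 := Finset.sum_le_sum fun l _ =>
          (hS.norm_projW_le κ j ε ℓ _).trans
            ((Q.norm_nonlinD_le hc hT (nm₀ s hs') (nml l s hs') j).trans_eq (by ring))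
      _ = _ := by simp
  choose! q hq1 hq2 using hq
  have hcu : ContinuousOn u₁ (Icc 0 T) :=
    h₁.contDiffOn.continuousOn.mono (Icc_subset_Icc_right hTτ)
  have hcw : ContinuousOn w (Icc 0 T) :=
    hw.contDiffOn.continuousOn.mono (Icc_subset_Icc_right hTτ)
  have hcb : ContinuousOn b (Icc 0 T) := P.continuous.comp_continuousOn
    (Q.continuousOn_nonlin (fun i => continuousOn_modeW
      ((hS.projW κ 1 ε ℓ₁).continuous.comp_continuousOn hcu) continuousOn_const i) j)
  have hdb : ∀ s ∈ Ioo 0 T, HasDerivAt b (b' s) s := fun s hs =>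
    P.hasFDerivAt.comp_hasDerivAt s (Q.hasDerivAt_nonlin (fun i => hasDerivAt_modeW
      ((hS.projW κ 1 ε ℓ₁).hasFDerivAt.comp_hasDerivAt s (h₁.hasDerivAt (hsub s hs)))
      (hasDerivAt_const _ _) i) j)
  have main := norm_le_of_transport (hS.measurable_freq κ ω j ε ℓ) (τ := T)
    (a := fun s => P (w s) - μ • b s)
    (a' := fun s => P (derivWithin w (Icc 0 τ) s) - μ • b' s)
    (f := fun s => (ε : ℂ) • P (Q.nonlin (m s) j - Q.nonlin (m₀ s) j) - μ • (b' s + q s))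
    (c := ε * (192 * c * B ^ 2 * η) + ε ^ 2 * G * (192 * c * B ^ 2 * (K * B + 64 * (c * B ^ 3))
        + K * (d * (192 * c * B ^ 3))))
    ((P.continuous.comp_continuousOn hcw).sub (hcb.const_smul μ))
    (fun s hs => (P.hasFDerivAt.comp_hasDerivAt s (hw.hasDerivAt (hsub s hs))).sub
      ((hdb s hs).const_smul μ))
    (fun s hs => by
      have hpde := hS.projW_eq hε j (hw.memW1 s (Ioo_subset_Icc_self (hsub s hs)))
        (heq s (Ioo_subset_Ioc_self (hsub s hs))) ℓ
      have ePN : P (Q.nonlin (m s) j - Q.nonlin (m₀ s) j) = P (Q.nonlin (m s) j) - b s :=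
        map_sub P _ _
      rw [ePN]
      rw [← hP] at hpde
      filter_upwards [hpde, hq1 s hs,
        Lp.coeFn_sub (P (derivWithin w (Icc 0 τ) s)) (μ • b' s), Lp.coeFn_smul μ (b' s),
        Lp.coeFn_sub (P (w s)) (μ • b s), Lp.coeFn_smul μ (b s),
        Lp.coeFn_sub ((ε : ℂ) • (P (Q.nonlin (m s) j) - b s)) (μ • (b' s + q s)),
        Lp.coeFn_smul (ε : ℂ) (P (Q.nonlin (m s) j) - b s),
        Lp.coeFn_sub (P (Q.nonlin (m s) j)) (b s), Lp.coeFn_smul μ (b' s + q s),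
        Lp.coeFn_add (b' s) (q s), Lp.coeFn_smul ε (P (Q.nonlin (m s) j))]
        with k e1 e2 e3 e4 e5 e6 e7 e8 e9 e10 e11 e12
      rw [e3, Pi.sub_apply, e4, Pi.smul_apply, e5, Pi.sub_apply, e6, Pi.smul_apply, e7,
        Pi.sub_apply, e8, Pi.smul_apply, e9, Pi.sub_apply, e10, Pi.smul_apply, e11, Pi.add_apply,
        e2, e1, e12, Pi.smul_apply, ← Complex.coe_smul ε]
      -- Normal form cancellation: writing `ε` in this way turns `-iφ·Pw + εb` into `-iφ(Pw - μb) -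
      -- μq`.
      have hμε : μ * (Complex.I * ((lamJ κ ω lam j ℓ 0 : ℂ) / (ε : ℂ))) = (ε : ℂ) := by
        rw [hμ]; field_simp
      have hsplit : (ε : ℂ) • b s k
          = (μ * (Complex.I * ((lamJ κ ω lam j ℓ 0 : ℂ) / (ε : ℂ)))) • b s k := by rw [hμε]
      rw [smul_sub (ε : ℂ), hsplit]
      push_cast
      module)
    (fun s hs => by
      refine (norm_sub_le _ _).trans (add_le_add ?_ ?_)
      · rw [norm_smul, Complex.norm_real, Real.norm_of_nonneg hε.le]
        gcongr
        exact (hS.norm_projW_le κ j ε ℓ _).trans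
          ((Q.norm_nonlin_sub_le hc hT (nm s (Ioo_subset_Icc_self hs))
            (nm₀ s (Ioo_subset_Icc_self hs)) (hsubm s hs) j).trans_eq (by ring))
      · rw [norm_smul]
        gcongr
        exact (norm_add_le _ _).trans (add_le_add (nb' s hs) (hq2 s hs)))
  intro t ht
  have h0 : (0 : ℝ) ∈ Icc 0 T := ⟨le_rfl, ht.1.trans ht.2⟩
  have hmb : ∀ s ∈ Icc 0 T, ‖μ • b s‖ ≤ ε ^ 2 * G * (64 * (c * B ^ 3)) := fun s hs => by
    rw [norm_smul]
    exact mul_le_mul hμn (nb s hs) (norm_nonneg _) (by positivity)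
  have i1 := main t ht
  have i2 := hmb t ht
  have i3 := hmb 0 h0
  have i4 : ‖P (w t)‖ ≤ ‖P (w t) - μ • b t‖ + ‖μ • b t‖ := by
    simpa using norm_add_le (P (w t) - μ • b t) (μ • b t)
  have i5 := norm_sub_le (P (w 0)) (μ • b 0)
  linarith

end SmoothEigendecomposition

end NonresonantModes

/-! ### Smallness of the nonresonant remainder. -/

section MainEstimate

variable {d n : ℕ} {Q : HypSystem d n} {K : ℝ} {lam : Fin n → Rd d → ℝ}
  {psi : Fin n → Rd d → Cn n}

namespace SmoothEigendecomposition

theorem toEuclideanLin_L_psi (hS : SmoothEigendecomposition Q K lam psi)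
    (α : ℝ) (β : Rd d) (ℓ : Fin n) :
    Matrix.toEuclideanLin (Q.L α β) (psi ℓ β) = ((lam ℓ β - α : ℝ) : ℂ) • psi ℓ β := by
  have h := Q.toEuclideanLin_L_add α β 0 (psi ℓ β)
  simp only [PiLp.zero_apply, Complex.ofReal_zero, zero_smul, Finset.sum_const_zero, add_zero] at h
  rw [h, hS.eigen, ← sub_smul]
  push_cast
  rfl

/-- Otherwise the one-dimensional kernel of `L(ω, κ)` would contain two orthonormal eigenvectors. -/
theorem lamJ_one_ne_zero (hS : SmoothEigendecomposition Q K lam psi)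
    {κ : Rd d} {ω : ℝ} {p : Wiener d n}
    (hp : PolarizationAssumption Q κ ω p) {ℓ ℓ₁ : Fin n} (hℓ₁ : lamJ κ ω lam 1 ℓ₁ 0 = 0)
    (hne : ℓ ≠ ℓ₁) : lamJ κ ω lam 1 ℓ 0 ≠ 0 := by
  intro h0
  have hker : ∀ i, lamJ κ ω lam 1 i 0 = 0 →
      psi i κ ∈ LinearMap.ker (Matrix.toEuclideanLin (Q.L ω κ)) := fun i hi => by
    rw [LinearMap.mem_ker, hS.toEuclideanLin_L_psi]
    have : lam i κ - ω = 0 := by simpa [lamJ] using hi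
    rw [this, Complex.ofReal_zero, zero_smul]
  obtain ⟨v, _, hv⟩ := finrank_eq_one_iff'.1 hp.ker_dim
  obtain ⟨a, ha⟩ := hv ⟨_, hker ℓ h0⟩
  obtain ⟨b, hb⟩ := hv ⟨_, hker ℓ₁ hℓ₁⟩
  have ha' : a • (v : Cn n) = psi ℓ κ := congrArg Subtype.val ha
  have hb' : b • (v : Cn n) = psi ℓ₁ κ := congrArg Subtype.val hb
  have hon := hS.orthonormal κ
  have horth : inner ℂ (psi ℓ κ) (psi ℓ₁ κ) = 0 := hon.2 hne
  have ha0 : psi ℓ κ ≠ 0 := hon.ne_zero ℓ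
  have hb0 : psi ℓ₁ κ ≠ 0 := hon.ne_zero ℓ₁
  rw [← ha', ← hb', inner_smul_left, inner_smul_right] at horth
  rw [← ha'] at ha0
  rw [← hb'] at hb0
  have := smul_ne_zero_iff.1 ha0
  have := smul_ne_zero_iff.1 hb0
  simp_all

theorem lamJ_three_ne_zero (hS : SmoothEigendecomposition Q K lam psi)
    {κ : Rd d} {ω : ℝ} {p : Wiener d n}
    (hp : PolarizationAssumption Q κ ω p) (ℓ : Fin n) : lamJ κ ω lam 3 ℓ 0 ≠ 0 := by
  intro h0
  have h1 := hS.toEuclideanLin_L_psi (3 * ω) ((3 : ℝ) • κ) ℓ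
  have h2 : lam ℓ ((3 : ℝ) • κ) - 3 * ω = 0 := by simpa [lamJ] using h0
  rw [h2, Complex.ofReal_zero, zero_smul] at h1
  have h3 : Matrix.mulVec (Q.L (3 * ω) ((3 : ℝ) • κ)) (psi ℓ ((3 : ℝ) • κ)).ofLp = 0 := by
    have := congrArg WithLp.ofLp h1
    simpa using this
  have h4 := Matrix.mulVec_injective_of_isUnit hp.invertible₃ (h3.trans (Matrix.mulVec_zero _).symm)
  exact (hS.orthonormal _).ne_zero ℓ (by ext m; exact congrFun h4 m)

/-- `‖P^⊥ z₁‖ + ‖z₃‖`, measured by the spectral components. -/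
noncomputable def remainder (hS : SmoothEigendecomposition Q K lam psi)
    (κ : Rd d) (ε : ℝ) (ℓ₁ : Fin n) (u₁ u₃ : Wiener d n) : ℝ :=
  ∑ ℓ ∈ Finset.univ.erase ℓ₁, ‖hS.projW κ 1 ε ℓ u₁‖ + ∑ ℓ, ‖hS.projW κ 3 ε ℓ u₃‖

theorem norm_sub_add_norm_le_remainder (hS : SmoothEigendecomposition Q K lam psi)
    (κ : Rd d) (ε : ℝ) (ℓ₁ : Fin n) (u₁ u₃ : Wiener d n) :
    ‖u₁ - hS.projW κ 1 ε ℓ₁ u₁‖ + ‖u₃‖ ≤ hS.remainder κ ε ℓ₁ u₁ u₃ :=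
  add_le_add (hS.norm_sub_projW_le κ 1 ε ℓ₁ u₁) (hS.norm_le_sum_projW κ 3 ε u₃)

end SmoothEigendecomposition

/-- The nonresonant part of the solution is `O(ε)` on the time scale `1/ε`. -/
theorem IsClassicalSolution.remainder_lt {κ : Rd d} {ω ε tend tstar M c B G D Y : ℝ}
    {p : Wiener d n} {u₁ u₃ : ℝ → Wiener d n} {ℓ₁ : Fin n}
    (hsol : IsClassicalSolution Q κ ω ε (tend / ε) p u₁ u₃)
    (hS : SmoothEigendecomposition Q K lam psi) (hK : 0 ≤ K) (hε : 0 < ε) (hε1 : ε ≤ 1)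
    (hc : 0 ≤ c) (hT : ∀ f g h : Wiener d n, ‖Q.triW f g h‖ ≤ c * ‖f‖ * ‖g‖ * ‖h‖)
    (hM : Wiener.normW1 p ≤ M) (hp1 : Wiener.MemW1 p) (hp : PolarizationAssumption Q κ ω p)
    (hℓ₁ : lamJ κ ω lam 1 ℓ₁ 0 = 0) (hG0 : 0 ≤ G)
    (hG : ∀ j ∈ ({1, 3} : Set ℕ), ∀ ℓ, lamJ κ ω lam j ℓ 0 ≠ 0 → |lamJ κ ω lam j ℓ 0|⁻¹ ≤ G)
    (htt : tstar ≤ tend)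
    (hB : ∀ t ∈ Icc 0 (tstar / ε), Wiener.normW1 (u₁ t) + Wiener.normW1 (u₃ t) ≤ B)
    (hD : D = 2 * G * K * M + 2 * (G * (64 * (c * B ^ 3))) + tend * (G *
      (192 * c * B ^ 2 * (K * B + 64 * (c * B ^ 3)) + K * (d * (192 * c * B ^ 3)))))
    (hY : Y = 4 * n * D + 1) (hsmall : tstar * (2 * n * (192 * c * B ^ 2)) ≤ 1 / 2) :
    ∀ t ∈ Icc 0 (tstar / ε), hS.remainder κ ε ℓ₁ (u₁ t) (u₃ t) < Y * ε := by
  have hM0 : 0 ≤ M := (Wiener.normW1_nonneg p).trans hM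
  have hτ : tstar / ε ≤ tend / ε := by gcongr
  have hcont : ContinuousOn (fun t => hS.remainder κ ε ℓ₁ (u₁ t) (u₃ t)) (Icc 0 (tstar / ε)) := by
    have c1 := hsol.regular₁.contDiffOn.continuousOn.mono (Icc_subset_Icc_right hτ)
    have c3 := hsol.regular₃.contDiffOn.continuousOn.mono (Icc_subset_Icc_right hτ)
    exact (continuousOn_finsetSum _ fun ℓ _ =>
      ((hS.projW κ 1 ε ℓ).continuous.comp_continuousOn c1).norm).add
      (continuousOn_finsetSum _ fun ℓ _ =>
        ((hS.projW κ 3 ε ℓ).continuous.comp_continuousOn c3).norm)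
  refine lt_of_bootstrap hcont fun t ht hbd => ?_
  have hB0 : 0 ≤ B := (add_nonneg (Wiener.normW1_nonneg _) (Wiener.normW1_nonneg _)).trans (hB t ht)
  have hεt : ε * t ≤ tstar := by
    have := (le_div_iff₀ hε).1 ht.2
    linarith
  have ht0 := ht.1
  have htstar : 0 ≤ tstar := (mul_nonneg hε.le ht0).trans hεt
  have htend : 0 ≤ tend := htstar.trans htt
  set D₁ := 192 * c * B ^ 2 * (K * B + 64 * (c * B ^ 3)) + K * (d * (192 * c * B ^ 3)) with hD₁
  have hD₁0 : 0 ≤ D₁ := by positivity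
  have hD0 : 0 ≤ D := by rw [hD]; positivity
  have hY0 : 0 ≤ Y := by rw [hY]; positivity
  have hBt : ∀ s ∈ Icc 0 t, Wiener.normW1 (u₁ s) + Wiener.normW1 (u₃ s) ≤ B := fun s hs =>
    hB s ⟨hs.1, hs.2.trans ht.2⟩
  have hη : ∀ s ∈ Ioo 0 t, ‖u₁ s - hS.projW κ 1 ε ℓ₁ (u₁ s)‖ + ‖u₃ s‖ ≤ Y * ε := fun s hs =>
    (hS.norm_sub_add_norm_le_remainder κ ε ℓ₁ _ _).trans (hbd s ⟨hs.1.le, hs.2⟩)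
  -- Common last step for `j = 1` and `j = 3`. The feedback term uses `εt ≤ tstar` to gain
  -- smallness; the slow forcing uses only `εt ≤ tend`, which keeps `D` independent of `tstar`.
  have comp : ∀ x z : ℝ, z ≤ ε * (2 * G * K * M) →
      x ≤ z + 2 * (ε ^ 2 * G * (64 * (c * B ^ 3)))
        + (ε * (192 * c * B ^ 2 * (Y * ε)) + ε ^ 2 * G * D₁) * t →
      x ≤ ε * (D + tstar * (192 * c * B ^ 2 * Y)) := by
    intro x z hz hx
    have hN : 0 ≤ G * (64 * (c * B ^ 3)) := by positivity
    have i1 : ε ^ 2 * G * (64 * (c * B ^ 3)) ≤ ε * (G * (64 * (c * B ^ 3))) := by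
      calc _ = ε * (ε * (G * (64 * (c * B ^ 3)))) := by ring
        _ ≤ ε * (1 * (G * (64 * (c * B ^ 3)))) := by gcongr
        _ = _ := by ring
    have i2 : (ε * (192 * c * B ^ 2 * (Y * ε)) + ε ^ 2 * G * D₁) * t
        ≤ ε * (tstar * (192 * c * B ^ 2 * Y) + tend * (G * D₁)) := by
      calc _ = ε * (ε * t * (192 * c * B ^ 2 * Y) + ε * t * (G * D₁)) := by ring
        _ ≤ _ := by
          gcongr
          exact hεt.trans htt
    rw [hD]
    linarith
  have comp1 : ∀ ℓ ∈ Finset.univ.erase ℓ₁, ‖hS.projW κ 1 ε ℓ (u₁ t)‖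
      ≤ ε * (D + tstar * (192 * c * B ^ 2 * Y)) := fun ℓ hℓ => by
    have hne := hS.lamJ_one_ne_zero hp hℓ₁ (Finset.ne_of_mem_erase hℓ)
    refine comp _ ‖hS.projW κ 1 ε ℓ (u₁ 0)‖ ?_
      (hS.norm_projW_le_of_nonresonant hK hε hε1 hc hT (ht.2.trans hτ) hsol.regular₁ hsol.regular₁
        hsol.eq₁ hsol.eq₁ hℓ₁ hne (hG 1 (by simp) ℓ hne) hBt hη t ⟨ht0, le_rfl⟩)
    rw [hsol.init₁]
    refine (hS.norm_projW_initial_le hK hε hp hp1 hne (hG 1 (by simp) ℓ hne)).trans ?_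
    gcongr
  have comp3 : ∀ ℓ ∈ Finset.univ, ‖hS.projW κ 3 ε ℓ (u₃ t)‖
      ≤ ε * (D + tstar * (192 * c * B ^ 2 * Y)) := fun ℓ _ => by
    have hne := hS.lamJ_three_ne_zero hp ℓ
    refine comp _ ‖hS.projW κ 3 ε ℓ (u₃ 0)‖ ?_
      (hS.norm_projW_le_of_nonresonant hK hε hε1 hc hT (ht.2.trans hτ) hsol.regular₁ hsol.regular₃
        hsol.eq₁ hsol.eq₃ hℓ₁ hne (hG 3 (by simp) ℓ hne) hBt hη t ⟨ht0, le_rfl⟩)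
    rw [hsol.init₃, map_zero, norm_zero]
    positivity
  have hZ0 : 0 ≤ ε * (D + tstar * (192 * c * B ^ 2 * Y)) := by positivity
  have s1 : ∑ ℓ ∈ Finset.univ.erase ℓ₁, ‖hS.projW κ 1 ε ℓ (u₁ t)‖
      ≤ n * (ε * (D + tstar * (192 * c * B ^ 2 * Y))) := by
    refine (Finset.sum_le_sum comp1).trans ?_
    rw [Finset.sum_const, nsmul_eq_mul]
    gcongr
    exact (Finset.card_le_univ _).trans_eq (Fintype.card_fin n)
  have s3 : ∑ ℓ, ‖hS.projW κ 3 ε ℓ (u₃ t)‖ ≤ n * (ε * (D + tstar * (192 * c * B ^ 2 * Y))) :=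
    (Finset.sum_le_sum comp3).trans_eq (by simp)
  have fin : tstar * (2 * n * (192 * c * B ^ 2)) * Y ≤ 1 / 2 * Y := by gcongr
  -- Half of `Y` absorbs the feedback; the other half is `2nD + 1/2`, which exceeds the direct
  -- contributions of at most `2n` components.
  have fin2 : 2 * n * D + tstar * (2 * n * (192 * c * B ^ 2)) * Y < Y := by
    have : 2 * n * D + 1 / 2 * Y < Y := by rw [hY]; linarith
    linarith
  calc _ ≤ _ := add_le_add s1 s3
    _ = (2 * n * D + tstar * (2 * n * (192 * c * B ^ 2)) * Y) * ε := by ring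
    _ < Y * ε := by gcongr

end MainEstimate

/-! ### Return to the variables `z_j`. -/

section Transformed

variable {d n : ℕ} {Q : HypSystem d n} {K : ℝ} {lam : Fin n → Rd d → ℝ}
  {psi : Fin n → Rd d → Cn n}

/-- The comparison is made for the lower Lebesgue integral, so `f` needs no measurability and the
lemma applies directly to `z_j`. -/
theorem Wiener.eLpNorm_le_of_ae {ι : Type*} (s : Finset ι) (g : ι → Wiener d n) {f : Rd d → Cn n}
    (h : ∀ᵐ k, ‖f k‖ ≤ ∑ i ∈ s, ‖g i k‖) :
    eLpNorm f 1 volume ≤ ENNReal.ofReal (∑ i ∈ s, ‖g i‖) := by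
  have hInt : Integrable fun k => ∑ i ∈ s, ‖g i k‖ :=
    integrable_finsetSum _ fun i _ => (integrable (g i)).norm
  have e : ∑ i ∈ s, ‖g i‖ = ∫ k, ∑ i ∈ s, ‖g i k‖ := by
    rw [integral_finsetSum _ fun i _ => (integrable (g i)).norm]
    simp only [L1.norm_eq_integral_norm]
  rw [e, ofReal_integral_eq_lintegral_ofReal hInt
    (.of_forall fun k => Finset.sum_nonneg fun _ _ => norm_nonneg _),
    eLpNorm_one_eq_lintegral_enorm]
  refine lintegral_mono_ae ?_
  filter_upwards [h] with k hk
  rw [← ofReal_norm]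
  exact ENNReal.ofReal_le_ofReal hk

theorem norm_le_sum_norm_apply (x : Cn n) : ‖x‖ ≤ ∑ ℓ, ‖x ℓ‖ := by
  have h : x = ∑ ℓ, EuclideanSpace.single ℓ (x ℓ) := by
    ext m
    simp [Finset.sum_apply]
  conv_lhs => rw [h]
  exact (norm_sum_le _ _).trans_eq (by simp)

theorem norm_sub_coordProj_le (ℓ₁ : Fin n) (x : Cn n) :
    ‖x - coordProj ℓ₁ x‖ ≤ ∑ ℓ ∈ Finset.univ.erase ℓ₁, ‖x ℓ‖ := by
  refine (norm_le_sum_norm_apply _).trans_eq ?_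
  rw [← Finset.add_sum_erase _ _ (Finset.mem_univ ℓ₁)]
  have h1 : (x - coordProj ℓ₁ x) ℓ₁ = 0 := by simp [coordProj]
  rw [h1, norm_zero, zero_add]
  refine Finset.sum_congr rfl fun ℓ hℓ => ?_
  have : ℓ ≠ ℓ₁ := Finset.ne_of_mem_erase hℓ
  simp [coordProj, this]

/-- The exponential factor is unimodular and the rows of `Ψ_j*` are the adjoint eigenvectors, so
only the modulus of the spectral coefficient remains. -/
theorem norm_zJ_apply (κ : Rd d) (ω : ℝ) (j : ℕ) (ε t : ℝ) (w : Wiener d n) (k : Rd d)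
    (ℓ : Fin n) :
    ‖zJ κ ω lam psi j ε t w k ℓ‖ = ‖inner ℂ (psi ℓ ((j : ℝ) • κ + ε • k)) (w k)‖ := by
  have h : zJ κ ω lam psi j ε t w k ℓ
      = Complex.exp (Complex.I * (t / ε * lamJ κ ω lam j ℓ (ε • k) : ℝ)) *
        inner ℂ (psi ℓ ((j : ℝ) • κ + ε • k)) (w k) := by
    have e : zJ κ ω lam psi j ε t w k ℓ = ∑ m, SJ κ ω lam psi j ε t k ℓ m * w k m := rfl
    rw [e, PiLp.inner_apply, Finset.mul_sum]
    refine Finset.sum_congr rfl fun m _ => ?_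
    simp only [SJ, Matrix.diagonal_mul, Matrix.conjTranspose_apply, PsiJ, Matrix.of_apply,
      RCLike.inner_apply, RCLike.star_def]
    ring
  rw [h, norm_mul, mul_comm Complex.I, Complex.norm_exp_ofReal_mul_I, one_mul]

theorem SmoothEigendecomposition.ae_norm_projW (hS : SmoothEigendecomposition Q K lam psi)
    (κ : Rd d) (ω : ℝ) (j : ℕ) (ε t : ℝ) (w : Wiener d n) :
    ∀ᵐ k, ∀ ℓ, ‖zJ κ ω lam psi j ε t w k ℓ‖ = ‖hS.projW κ j ε ℓ w k‖ := by
  filter_upwards [ae_all_iff.2 fun ℓ => hS.coeFn_projW κ j ε ℓ w] with k hk ℓ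
  rw [norm_zJ_apply, hk ℓ, norm_smul, (hS.orthonormal _).1 ℓ, mul_one]

theorem ENNReal.weighted_sum_le {x y z : ℝ≥0∞} {ε B S₁ S₃ Y r : ℝ} (hε : 0 < ε) (hB : 0 ≤ B)
    (hS₁ : 0 ≤ S₁) (hS₃ : 0 ≤ S₃) (hx : x ≤ ENNReal.ofReal B) (hy : y ≤ ENNReal.ofReal S₁)
    (hz : z ≤ ENNReal.ofReal S₃) (hY : S₁ + S₃ ≤ Y * ε) (hr : 2 * B + 2 * Y ≤ r) :
    2 * x + ENNReal.ofReal (2 / ε) * y + ENNReal.ofReal (2 / ε) * z ≤ ENNReal.ofReal r := by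
  have h2ε : 0 ≤ 2 / ε := by positivity
  have h2 : (2 : ℝ≥0∞) = ENNReal.ofReal 2 := by simp
  calc _ ≤ 2 * ENNReal.ofReal B + ENNReal.ofReal (2 / ε) * ENNReal.ofReal S₁
        + ENNReal.ofReal (2 / ε) * ENNReal.ofReal S₃ := by gcongr
    _ = ENNReal.ofReal (2 * B + 2 / ε * S₁ + 2 / ε * S₃) := by
        rw [ENNReal.ofReal_add (by positivity) (by positivity),
          ENNReal.ofReal_add (by positivity) (by positivity), ENNReal.ofReal_mul zero_le_two,
          ENNReal.ofReal_mul h2ε, ENNReal.ofReal_mul h2ε, ← h2]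
    _ ≤ _ := by
        refine ENNReal.ofReal_le_ofReal ?_
        have : 2 / ε * S₁ + 2 / ε * S₃ ≤ 2 * Y := by
          rw [← mul_add, div_mul_eq_mul_div, div_le_iff₀ hε]
          linarith
        linarith

theorem SmoothEigendecomposition.scaledNorm_le (hS : SmoothEigendecomposition Q K lam psi)
    (κ : Rd d) (ω : ℝ) {ε : ℝ} (hε : 0 < ε) (t : ℝ) (ℓ₁ : Fin n) (u₁ u₃ : Wiener d n) {B Y r : ℝ}
    (hB : ‖u₁‖ ≤ B) (hY : hS.remainder κ ε ℓ₁ u₁ u₃ ≤ Y * ε) (hr : 2 * B + 2 * Y ≤ r) :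
    scaledNorm ℓ₁ ε (zJ κ ω lam psi 1 ε t u₁) (zJ κ ω lam psi 3 ε t u₃) ≤ ENNReal.ofReal r := by
  have a : eLpNorm (fun k => coordProj ℓ₁ (zJ κ ω lam psi 1 ε t u₁ k)) 1 volume
      ≤ ENNReal.ofReal B := by
    refine (Wiener.eLpNorm_le_of_ae {ℓ₁} (fun ℓ => hS.projW κ 1 ε ℓ u₁) ?_).trans ?_
    · filter_upwards [hS.ae_norm_projW κ ω 1 ε t u₁] with k hk
      rw [Finset.sum_singleton, ← hk ℓ₁]
      simp [coordProj]
    · rw [Finset.sum_singleton]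
      exact ENNReal.ofReal_le_ofReal ((hS.norm_projW_le κ 1 ε ℓ₁ u₁).trans hB)
  have b : eLpNorm (fun k => zJ κ ω lam psi 1 ε t u₁ k - coordProj ℓ₁ (zJ κ ω lam psi 1 ε t u₁ k))
      1 volume ≤ ENNReal.ofReal (∑ ℓ ∈ Finset.univ.erase ℓ₁, ‖hS.projW κ 1 ε ℓ u₁‖) := by
    refine Wiener.eLpNorm_le_of_ae _ (fun ℓ => hS.projW κ 1 ε ℓ u₁) ?_
    filter_upwards [hS.ae_norm_projW κ ω 1 ε t u₁] with k hk
    refine (norm_sub_coordProj_le ℓ₁ _).trans_eq ?_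
    simp only [hk]
  have c : eLpNorm (zJ κ ω lam psi 3 ε t u₃) 1 volume
      ≤ ENNReal.ofReal (∑ ℓ, ‖hS.projW κ 3 ε ℓ u₃‖) := by
    refine Wiener.eLpNorm_le_of_ae _ (fun ℓ => hS.projW κ 3 ε ℓ u₃) ?_
    filter_upwards [hS.ae_norm_projW κ ω 3 ε t u₃] with k hk
    refine (norm_le_sum_norm_apply _).trans_eq ?_
    simp only [hk]
  exact ENNReal.weighted_sum_le hε ((norm_nonneg _).trans hB)
    (Finset.sum_nonneg fun _ _ => norm_nonneg _) (Finset.sum_nonneg fun _ _ => norm_nonneg _)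
    a b c hY hr

theorem SmoothEigendecomposition.eLpNorm_sub_eigProj_le
    (hS : SmoothEigendecomposition Q K lam psi) (κ : Rd d) (ε : ℝ) (ℓ₁ : Fin n)
    (u : Wiener d n) :
    eLpNorm (fun k => u k - eigProj κ psi ℓ₁ ε u k) 1 volume
      ≤ ENNReal.ofReal ‖u - hS.projW κ 1 ε ℓ₁ u‖ := by
  refine (Wiener.eLpNorm_le_of_ae {()} (fun _ => u - hS.projW κ 1 ε ℓ₁ u) ?_).trans_eq (by simp)
  filter_upwards [hS.coeFn_projW κ 1 ε ℓ₁ u, Lp.coeFn_sub u (hS.projW κ 1 ε ℓ₁ u)] with k h1 h2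
  rw [Finset.sum_singleton, h2, Pi.sub_apply, h1]
  simp [eigProj]

end Transformed

/-! ### Choice of constants and conclusion. -/

theorem SmoothEigendecomposition.mono {d n : ℕ} {Q : HypSystem d n} {K K' : ℝ}
    {lam : Fin n → Rd d → ℝ} {psi : Fin n → Rd d → Cn n}
    (hS : SmoothEigendecomposition Q K lam psi) (hK : K ≤ K') :
    SmoothEigendecomposition Q K' lam psi :=
  { hS with
    lipschitz := fun ℓ β β' => (hS.lipschitz ℓ β β').trans
      (mul_le_mul_of_nonneg_right hK (Finset.sum_nonneg fun _ _ => abs_nonneg _)) }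

/-- `M` bounds `‖p‖_{W¹}`, `CT` is the constant in `|T(a,b,c)| ≤ CT |a| |b| |c|`, `K` is the Lipschitz
constant of the eigenvalues, and `G` bounds the inverses of the nonzero eigenvalues of `L₁(0)` and
`L₃(0)`. The threshold for `r` and `tstar` depend on nothing else, besides `d`, `n` and `tend`. -/
theorem proposition1 (d n : ℕ) (tend M CT K G : ℝ) (htend : 0 < tend) :
    ∃ C : ℝ, ∀ r : ℝ, C < r → ∃ tstar ∈ Set.Ioc 0 tend,
      ∀ (Q : HypSystem d n) (κ : Rd d) (ω : ℝ) (p : Wiener d n)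
        (lam : Fin n → Rd d → ℝ) (psi : Fin n → Rd d → Cn n) (ℓ₁ : Fin n),
        κ ≠ 0 →
        (∀ a b c : Cn n, ‖Q.TC a b c‖ ≤ CT * ‖a‖ * ‖b‖ * ‖c‖) →
        Wiener.MemW1 p → Wiener.normW1 p ≤ M →
        PolarizationAssumption Q κ ω p →
        SmoothEigendecomposition Q K lam psi →
        lamJ κ ω lam 1 ℓ₁ 0 = 0 →
        (∀ j ∈ ({1, 3} : Set ℕ), ∀ ℓ, lamJ κ ω lam j ℓ 0 ≠ 0 → |lamJ κ ω lam j ℓ 0|⁻¹ ≤ G) →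
        ∀ ε ∈ Set.Ioc (0 : ℝ) 1, ∀ u₁ u₃ : ℝ → Wiener d n,
          IsClassicalSolution Q κ ω ε (tend / ε) p u₁ u₃ →
          ∀ t ∈ Set.Icc 0 (tstar / ε),
            scaledNorm ℓ₁ ε (zJ κ ω lam psi 1 ε t (u₁ t)) (zJ κ ω lam psi 3 ε t (u₃ t))
                ≤ ENNReal.ofReal r ∧
            eLpNorm (fun k => u₁ t k - eigProj κ psi ℓ₁ ε (u₁ t) k) 1 volume
                ≤ ENNReal.ofReal (r / 2 * ε) ∧
            ‖u₃ t‖ ≤ r / 2 * ε := by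
  set c := Wiener.evalConst d ^ 2 * |CT| with hc
  have hc0 : 0 ≤ c := by positivity
  set B : ℝ := n * |M| + 1 with hB
  have hB0 : 0 < B := by positivity
  set D : ℝ := 2 * |G| * |K| * |M| + 2 * (|G| * (64 * (c * B ^ 3))) + tend * (|G| *
      (192 * c * B ^ 2 * (|K| * B + 64 * (c * B ^ 3)) + |K| * (d * (192 * c * B ^ 3)))) with hD
  set Y : ℝ := 4 * n * D + 1 with hY
  set A₁ : ℝ := n * (2 * (d + 1) * (192 * (c * B ^ 3))) with hA₁
  set A₂ : ℝ := 2 * n * (192 * c * B ^ 2) with hA₂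
  have hA₁0 : 0 ≤ A₁ := by positivity
  have hA₂0 : 0 ≤ A₂ := by positivity
  -- `B` bounds `‖Pz₁‖`, and `Yε` bounds the remainder. Both are fixed before `tstar`, which is then
  -- chosen with `tstar * A₁ < 1` for the `W¹` bound and `tstar * A₂ ≤ 1/2` for the remainder.
  refine ⟨2 * B + 2 * Y, fun r hr => ⟨min tend (1 / (2 * (A₁ + A₂ + 1))),
    ⟨lt_min htend (by positivity), min_le_left _ _⟩, ?_⟩⟩
  set tstar := min tend (1 / (2 * (A₁ + A₂ + 1))) with htstar
  have hts : tstar * (2 * (A₁ + A₂ + 1)) ≤ 1 :=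
    (le_div_iff₀ (by positivity)).1 (min_le_right _ _)
  have hts0 : 0 < tstar := lt_min htend (by positivity)
  have hsmall₁ : tstar * A₁ < 1 := by
    have := mul_nonneg hts0.le hA₁0
    have := mul_nonneg hts0.le hA₂0
    linarith
  have hsmall₂ : tstar * A₂ ≤ 1 / 2 := by
    have := mul_nonneg hts0.le hA₁0
    linarith
  intro Q κ ω p lam psi ℓ₁ _ hTC hp1 hpM hp hS' hℓ₁ hG ε hε u₁ u₃ hsol t ht
  -- The given upper bounds carry no sign condition, so each is weakened to its absolute value.
  have hS := hS'.mono (le_abs_self K)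
  have hTC' : ∀ a b c : Cn n, ‖Q.TC a b c‖ ≤ |CT| * ‖a‖ * ‖b‖ * ‖c‖ := fun a b c =>
    (hTC a b c).trans (by gcongr; exact le_abs_self CT)
  have hT : ∀ f g h : Wiener d n, ‖Q.triW f g h‖ ≤ c * ‖f‖ * ‖g‖ * ‖h‖ :=
    Q.norm_triW_le (abs_nonneg CT) hTC'
  have hM' : Wiener.normW1 p ≤ |M| := hpM.trans (le_abs_self M)
  have hX := hsol.normW1_lt hS hε.1 hc0 hT hM' (min_le_left _ _) hB hsmall₁
  have hR := hsol.remainder_lt hS (abs_nonneg K) hε.1 hε.2 hc0 hT hM' hp1 hp hℓ₁ (abs_nonneg G)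
    (fun j hj ℓ h => (hG j hj ℓ h).trans (le_abs_self G)) (min_le_left _ _)
    (fun s hs => (hX s hs).le) hD hY hsmall₂ t ht
  have hXt := hX t ht
  have hu₁ : ‖u₁ t‖ ≤ B := by
    have h1 := Wiener.norm_le_normW1 (u₁ t)
    have h3 := Wiener.normW1_nonneg (u₃ t)
    linarith
  have hsum := hS.norm_sub_add_norm_le_remainder κ ε ℓ₁ (u₁ t) (u₃ t)
  have hYr : Y * ε ≤ r / 2 * ε := mul_le_mul_of_nonneg_right (by linarith) hε.1.le
  have hn1 := norm_nonneg (u₁ t - hS.projW κ 1 ε ℓ₁ (u₁ t))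
  have hn3 := norm_nonneg (u₃ t)
  refine ⟨hS.scaledNorm_le κ ω hε.1 t ℓ₁ (u₁ t) (u₃ t) hu₁ hR.le hr.le, ?_, by linarith⟩
  exact (hS.eLpNorm_sub_eigProj_le κ ε ℓ₁ (u₁ t)).trans (ENNReal.ofReal_le_ofReal (by linarith))
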